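/- **Setting.** Let a directed graph be given with arc set $\mathcal A$, a finite family of origin–destination (OD) pairs $k=1,\dots,W$ and a finite family $\mathcal R$ of $N$ simple paths, each joining the origin to the destination of one OD pair $k(r)$. Let $\Delta\in\{0,1\}^{\mathcal A\times\mathcal R}$ be the arc–path incidence matrix, $\Pi\in\{0,1\}^{W\times\mathcal R}$ the OD–path incidence matrix, $q\in\mathbb R^W$ the demand, $D=\{f\in\mathbb R^N_+:\Pi f=q\}$, and $\mathcal N_D(f)=\{w: w^\top(g-f)\le 0\ \forall g\in D\}$ for $f\in D$, $\mathcal N_D(f)=\emptyset$ for $f\notin D$. Norms are Euclidean, respectively operator norms for the Euclidean norms; $\eta_\Delta=\|\Delta\|$, $\eta_{\Delta^\top}=\|\Delta^\top\|$. Let $\Xi\subseteq\mathbb R^k$, let $T(v,\xi)\in\mathbb R^{\mathcal A}$ be the arc travel times under arc flow $v\in\mathbb R^{\mathcal A}$ and random factor $\xi$, with $T(\cdot,\xi)$ continuously differentiable for each $\xi\in\Xi$, and let $C(f,\xi)=\Delta^\top T(\Delta f,\xi)$. For $t>0$ let $$h(z,t)=\begin{cases} z,& z>t,\\ \frac{1}{4t}(z^2+2zt+t^2),&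 -t\le z\le t,\\ 0,& z<-t,\end{cases}$$ and $\hat u_t(f,\xi)=\theta_0 d+\theta_1C(f,\xi)+\theta_2h(C(f,\xi)-\tau,t)$, with $h$ acting componentwise, $\theta_0\in\mathbb R$, $\theta_1,\theta_2\ge0$, $d\in\mathbb R^N$ and $\tau_r=\tau_{k(r)}$ the longest acceptable travel time of the OD pair of $r$. Put $\hat\phi_t(f,Q)=\mathbb E_Q[\hat u_t(f,\xi)]$. The modified late-arrival-penalised user equilibria (MLAPUE) under $Q$ are the elements of $\mathcal F_t(Q)=\{f: 0\in\hat\phi_t(f,Q)+\mathcal N_D(f)\}$. An MLAPUE $f_0\in\mathcal F_t(Q)$ is *strongly regular* if there are neighbourhoods $\mathcal V$ of $f_0$ and $\mathcal V_0$ of $0\in\mathbb R^N$ such that for each $\delta\in\mathcal V_0$ the linearized equation $\delta\in\hat\phi_t(f_0,Q)+\nabla_f\hat\phi_t(f_0,Q)(f-f_0)+\mathcal N_D(f)$ has exactly one solution $f$ in $\mathcal V$, and this solution is Lipschitz continuous in $\delta\in\mathcal V_0$. Fix $t>0$ and a convex compact set $\mathbb F_t\subset\mathbb R^N$, and let $\mathbb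 V_t=\Delta\mathbb F_t$. Let $C_0'=\sup_{f\in\mathbb F_t,\xi\in\Xi}\|\nabla_fC(f,\xi)\|$ and $\hat C(t)=\frac{C_0'}{2t}$. Assume that $\Xi$ is compact or, more generally, that $\Xi$ is closed and $C_0'<\infty$, and that there is $L>0$ with $$\|T(v,\xi)-T(v,\xi')\|\le L\|\xi-\xi'\|,\qquad \|\nabla_vT(v,\xi)-\nabla_vT(v,\xi')\|\le L\|\xi-\xi'\|\qquad(v\in\mathbb V_t,\ \xi,\xi'\in\Xi).$$ Let $\mathscr P(\Xi)$ be the set of probability measures on $\Xi$, $\mathcal M^1=\{Q\in\mathscr P(\Xi):\int\|\xi\|\,dQ<\infty\}$, $\mathcal M^\gamma_{M_0}=\{Q\in\mathscr P(\Xi):\int\|\xi\|^\gamma dQ\le M_0\}$, and let $d_K(P,Q)=\sup\{|\int\varphi\,dP-\int\varphi\,dQ|:\varphi:\mathbb R^k\to\mathbb R\ \text{1-Lipschitz}\}$ be the Kantorovich metric. **Theorem (Stability of MLAPUE).** (i) Let $P\in\mathcal M^1$ and let $f_t(P)\in\mathcal F_t(P)$ be strongly regular and interior to $\mathbb F_t$.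 Then there are constants $\delta,\kappa>0$, a neighbourhood $\mathcal V$ of $f_t(P)$ and a map $f_t(\cdot)$ extending $f_t(P)$ such that for every $Q\in\mathcal M^1$ with $d_K(Q,P)\le\delta$ the point $f_t(Q)$ is the unique element of $\mathcal F_t(Q)\cap\mathcal V$, and $$\|f_t(Q_1)-f_t(Q_2)\|\le L\,\eta_{\Delta^\top}\,\kappa\,\bigl(\theta_1+\theta_2+\theta_1\eta_\Delta+\theta_2\eta_\Delta+\theta_2\hat C(t)\bigr)\,d_K(Q_1,Q_2)$$ for all $Q_1,Q_2\in\mathcal M^1$ with $d_K(Q_1,P)\le\delta$ and $d_K(Q_2,P)\le\delta$. (ii) Let $\gamma>1$, $M_0>0$, and let $f_t(\cdot):\mathcal M^\gamma_{M_0}\to\mathbb R^N$ be continuous with respect to $d_K$ and such that, for every $Q\in\mathcal M^\gamma_{M_0}$, $f_t(Q)$ is a strongly regular element of $\mathcal F_t(Q)$ and is interior to $\mathbb F_t$. Then there is a constant $\tilde C>0$ such that $$\|f_t(Q_1)-f_t(Q_2)\|\le L\,\tilde C\,\eta_{\Delta^\top}\,\bigl(\theta_1+\theta_2+\theta_1\eta_\Delta+\theta_2\eta_\Delta+\theta_2\hat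 C(t)\bigr)\,d_K(Q_1,Q_2)\qquad\text{for all }Q_1,Q_2\in\mathcal M^\gamma_{M_0}.$$ -/

import Mathlib

open MeasureTheory Set Filter Topology
open scoped NNReal ENNReal

noncomputable section

namespace MLAPUE

/-! ### Transportation network -/

/-- The list `l` of arcs is a directed walk from `u` to `v`, when arc `a` leads from `tail a` to
`head a`. -/
def IsWalk {Node Arc : Type*} (tail head : Arc → Node) : Node → List Arc → Node → Prop
  | u, [], v => u = v
  | u, a :: l, v => tail a = u ∧ IsWalk tail head (head a) l v

/-- A directed graph with arcs `Arc`, a family of origin-destination pairs indexed by `OD`, and a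
family of paths indexed by `Route`. The paths of the `k`-th OD pair are those `r` with
`od r = k`; each of them is a directed walk from the origin to the destination of that pair which
visits no node twice. -/
structure Network (Node Arc OD Route : Type*) where
  tail : Arc → Node
  head : Arc → Node
  orig : OD → Node
  dest : OD → Node
  od : Route → OD
  arcs : Route → List Arc
  isWalk : ∀ r, IsWalk tail head (orig (od r)) (arcs r) (dest (od r))
  simple : ∀ r, (orig (od r) :: (arcs r).map head).Nodup

section Incidence

variable {Node Arc OD Route : Type*}

open Classical in
/-- Arc-path incidence matrix `Δ`. -/
def Network.arcPath (G : Network Node Arc OD Route) : Matrix Arc Route ℝ :=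
  Matrix.of fun a r => if a ∈ G.arcs r then 1 else 0

open Classical in
/-- OD-path incidence matrix `Π`. -/
def Network.odPath (G : Network Node Arc OD Route) : Matrix OD Route ℝ :=
  Matrix.of fun k r => if G.od r = k then 1 else 0

end Incidence

/-- A real matrix as a continuous linear map between Euclidean spaces; the norm of this map is the
operator norm of the matrix for the Euclidean norms. -/
def matCLM {m n : Type*} [Fintype m] [Fintype n] (A : Matrix m n ℝ) :
    EuclideanSpace ℝ n →L[ℝ] EuclideanSpace ℝ m :=
  LinearMap.toContinuousLinearMap
    { toFun := fun x => WithLp.toLp 2 (A.mulVec (WithLp.ofLp x))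
      map_add' := fun x y => by simp [Matrix.mulVec_add]
      map_smul' := fun c x => by simp [Matrix.mulVec_smul] }

/-! ### The model -/

/-- The penalty function for lateness. -/
def penalty (z t : ℝ) : ℝ :=
  if t < z then z else if -t ≤ z then (z ^ 2 + 2 * z * t + t ^ 2) / (4 * t) else 0

/-- The data of the model: a network, the demands `q`, the flow-independent path attributes `d`,
the longest acceptable travel times `τ` of the OD pairs, the weights `θ₀, θ₁, θ₂`, and the arc
travel times `T v ξ` under the arc flow `v` and the random factors `ξ`. -/
structure Model (Node Arc OD Route : Type*) [Fintype Arc] [Fintype OD] [Fintype Route]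
    (k : ℕ) where
  net : Network Node Arc OD Route
  q : OD → ℝ
  d : EuclideanSpace ℝ Route
  τ : OD → ℝ
  θ₀ : ℝ
  θ₁ : ℝ
  θ₂ : ℝ
  T : EuclideanSpace ℝ Arc → EuclideanSpace ℝ (Fin k) → EuclideanSpace ℝ Arc

namespace Model

variable {Node Arc OD Route : Type*} [Fintype Arc] [Fintype OD] [Fintype Route] {k : ℕ}
  (M : Model Node Arc OD Route k)

/-- The matrix `Δ` as a linear map. -/
def Δ : EuclideanSpace ℝ Route →L[ℝ] EuclideanSpace ℝ Arc := matCLM M.net.arcPath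

/-- The matrix `Δᵀ` as a linear map. -/
def ΔT : EuclideanSpace ℝ Arc →L[ℝ] EuclideanSpace ℝ Route := matCLM M.net.arcPath.transpose

/-- The set `D = {f ≥ 0 : Π f = q}` of demand-feasible path flows. -/
def feasible : Set (EuclideanSpace ℝ Route) :=
  {f | (∀ r, 0 ≤ f r) ∧ M.net.odPath.mulVec (WithLp.ofLp f) = M.q}

/-- Path travel times `C(f, ξ) = Δᵀ T(Δ f, ξ)`. -/
def pathTime (f : EuclideanSpace ℝ Route) (ξ : EuclideanSpace ℝ (Fin k)) :
    EuclideanSpace ℝ Route :=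
  M.ΔT (M.T (M.Δ f) ξ)

/-- The modified disutility `û(f, C(f, ξ), t) = θ₀ d + θ₁ C(f, ξ) + θ₂ h(C(f, ξ) - τ, t)`, with
the penalty `h` acting componentwise. -/
def disutility (t : ℝ) (f : EuclideanSpace ℝ Route) (ξ : EuclideanSpace ℝ (Fin k)) :
    EuclideanSpace ℝ Route :=
  WithLp.toLp 2 fun r =>
    M.θ₀ * M.d r + M.θ₁ * M.pathTime f ξ r
      + M.θ₂ * penalty (M.pathTime f ξ r - M.τ (M.net.od r)) t

/-- The expected disutility `φ̂_t(f, Q) = E_Q[û(f, C(f, ξ), t)]`. -/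
def expDisutility (t : ℝ) (Q : ProbabilityMeasure (EuclideanSpace ℝ (Fin k)))
    (f : EuclideanSpace ℝ Route) : EuclideanSpace ℝ Route :=
  ∫ ξ, M.disutility t f ξ ∂(Q : Measure (EuclideanSpace ℝ (Fin k)))

end Model

/-! ### Generalized equations -/

/-- The normal cone of the convex set `D` at `f`; as usual it is empty when `f ∉ D`. -/
def normalCone {E : Type*} [NormedAddCommGroup E] [InnerProductSpace ℝ E] (D : Set E) (f : E) :
    Set E :=
  {w | f ∈ D ∧ ∀ g ∈ D, inner ℝ w (g - f) ≤ 0}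

/-- The solutions `z` of the generalized equation `0 ∈ φ z + N z`. -/
def geSolutions {Z W : Type*} [AddCommGroup W] (φ : Z → W) (N : Z → Set W) : Set Z :=
  {z | ∃ w ∈ N z, φ z + w = 0}

/-- Strong regularity of a solution `z₀` of `0 ∈ φ z + N z`, for `φ` continuously differentiable
near `z₀`: for all `δ` near `0`, the linearized equation `δ ∈ φ z₀ + Dφ(z₀)(z - z₀) + N z` has
exactly one solution `ζ δ` in a neighbourhood of `z₀`, and `ζ` is Lipschitz continuous. -/
def StronglyRegular {Z W : Type*} [NormedAddCommGroup Z] [NormedSpace ℝ Z]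
    [NormedAddCommGroup W] [NormedSpace ℝ W] (φ : Z → W) (N : Z → Set W) (z₀ : Z) : Prop :=
  z₀ ∈ geSolutions φ N ∧
    ∃ VZ ∈ 𝓝 z₀, ∃ VW ∈ 𝓝 (0 : W), ∃ (ζ : W → Z) (c : ℝ≥0),
      (∀ δ ∈ VW, {z ∈ VZ | ∃ w ∈ N z, φ z₀ + fderiv ℝ φ z₀ (z - z₀) + w = δ} = {ζ δ}) ∧
      LipschitzOnWith c ζ VW

/-! ### Spaces of probability measures -/

section Prob

variable {k : ℕ}

/-- The Kantorovich metric. It is used only between measures with finite first moment, where the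
integrals exist and the supremum is finite. -/
def dK (P Q : ProbabilityMeasure (EuclideanSpace ℝ (Fin k))) : ℝ :=
  ⨆ φ : {φ : EuclideanSpace ℝ (Fin k) → ℝ // LipschitzWith 1 φ},
    |∫ ξ, φ.1 ξ ∂(P : Measure (EuclideanSpace ℝ (Fin k)))
      - ∫ ξ, φ.1 ξ ∂(Q : Measure (EuclideanSpace ℝ (Fin k)))|

/-- The probability measures on `Ξ`, as probability measures on `ℝᵏ` that do not charge the
complement of `Ξ`. -/
def probOn (Ξ : Set (EuclideanSpace ℝ (Fin k))) :
    Set (ProbabilityMeasure (EuclideanSpace ℝ (Fin k))) :=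
  {Q | (Q : Measure (EuclideanSpace ℝ (Fin k))) Ξᶜ = 0}

/-- The probability measures on `Ξ` with finite first moment. -/
def finiteMoment (Ξ : Set (EuclideanSpace ℝ (Fin k))) :
    Set (ProbabilityMeasure (EuclideanSpace ℝ (Fin k))) :=
  {Q ∈ probOn Ξ | ∫⁻ ξ, ‖ξ‖ₑ ∂(Q : Measure (EuclideanSpace ℝ (Fin k))) < ∞}

/-- The probability measures on `Ξ` with `γ`-th moment at most `M₀`. -/
def boundedMoment (Ξ : Set (EuclideanSpace ℝ (Fin k))) (γ M₀ : ℝ) :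
    Set (ProbabilityMeasure (EuclideanSpace ℝ (Fin k))) :=
  {Q ∈ probOn Ξ |
    ∫⁻ ξ, ‖ξ‖ₑ ^ γ ∂(Q : Measure (EuclideanSpace ℝ (Fin k))) ≤ ENNReal.ofReal M₀}

end Prob

/-! ### Solutions, assumption and constants -/

namespace Model

variable {Node Arc OD Route : Type*} [Fintype Arc] [Fintype OD] [Fintype Route] {k : ℕ}
  (M : Model Node Arc OD Route k)

/-- The set of modified late-arrival-penalised user equilibria under `Q`: the solutions of
`0 ∈ E_Q[û(f, C(f, ξ), t)] + N_D(f)`. -/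
def equilibria (t : ℝ) (Q : ProbabilityMeasure (EuclideanSpace ℝ (Fin k))) :
    Set (EuclideanSpace ℝ Route) :=
  geSolutions (M.expDisutility t Q) (normalCone M.feasible)

/-- `f` is a strongly regular equilibrium under `Q`. -/
def IsRegularEquilibrium (t : ℝ) (Q : ProbabilityMeasure (EuclideanSpace ℝ (Fin k)))
    (f : EuclideanSpace ℝ Route) : Prop :=
  StronglyRegular (M.expDisutility t Q) (normalCone M.feasible) f

/-- On the arc flows `v = Δ f` with `f ∈ F`, the arc travel times and their Jacobians in `v` are
Lipschitz continuous in `ξ ∈ Ξ` with modulus `L`. -/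
def LipschitzTravelTime (F : Set (EuclideanSpace ℝ Route)) (Ξ : Set (EuclideanSpace ℝ (Fin k)))
    (L : ℝ) : Prop :=
  ∀ v ∈ M.Δ '' F, ∀ ξ ∈ Ξ, ∀ ξ' ∈ Ξ,
    ‖M.T v ξ - M.T v ξ'‖ ≤ L * ‖ξ - ξ'‖ ∧
    ‖fderiv ℝ (fun u => M.T u ξ) v - fderiv ℝ (fun u => M.T u ξ') v‖ ≤ L * ‖ξ - ξ'‖

/-- The norms `‖∇_f C(f, ξ)‖` for `f ∈ F`, `ξ ∈ Ξ`. -/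
def jacobianNorms (F : Set (EuclideanSpace ℝ Route)) (Ξ : Set (EuclideanSpace ℝ (Fin k))) :
    Set ℝ :=
  {x | ∃ f ∈ F, ∃ ξ ∈ Ξ, x = ‖fderiv ℝ (fun g => M.pathTime g ξ) f‖}

/-- `Ĉ(t) = C₀' / (2t)` with `C₀' = sup ‖∇_f C(f, ξ)‖` over `f ∈ F`, `ξ ∈ Ξ`. -/
def CHat (F : Set (EuclideanSpace ℝ Route)) (Ξ : Set (EuclideanSpace ℝ (Fin k))) (t : ℝ) : ℝ :=
  sSup (M.jacobianNorms F Ξ) / (2 * t)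

/-- `L ‖Δᵀ‖ (θ₁ + θ₂ + θ₁ ‖Δ‖ + θ₂ ‖Δ‖ + θ₂ Ĉ(t))`. -/
def stabilityConst (F : Set (EuclideanSpace ℝ Route)) (Ξ : Set (EuclideanSpace ℝ (Fin k)))
    (L t : ℝ) : ℝ :=
  L * ‖M.ΔT‖ * (M.θ₁ + M.θ₂ + M.θ₁ * ‖M.Δ‖ + M.θ₂ * ‖M.Δ‖ + M.θ₂ * M.CHat F Ξ t)

end Model

end MLAPUE

end

/-! An equilibrium solves a generalized equation whose single-valued part is an expectation, so
stability in the measure follows from Robinson's implicit function theorem once a change of measure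
is seen to be a small C¹-type perturbation of that part.

For the perturbation bounds, the disutility and its Jacobian in `f` are Lipschitz in `ξ`, uniformly
over the convex set `F`. The penalty is C¹ with slope at most 1, and its slope is
`1/(2t)`-Lipschitz; with the chain and product rules this gives the modulus `stabilityConst`.
Kantorovich duality turns moduli in `ξ` into factors of `dK`: the expectations under `P` and `Q`
differ by at most `S * dK P Q` at each point, and by the mean value inequality their difference is
`S * dK P Q`-Lipschitz in `f`. These are the smallness conditions of
`StronglyRegular.exists_stable`, and part (i) follows.

For part (ii), the local constants depend on the measure. A moment bound of order `γ > 1` makes the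
set of measures sequentially compact for `dK` (`exists_tendsto_dK_subseq`), so one constant serves
at every measure, although the radius of validity may vary. The set is also convex, and a segment
joining two measures has constant speed for `dK`; the pointwise estimate is propagated along it by
`norm_sub_le_of_forall_locally`. -/

noncomputable section

namespace MLAPUE

/-! ### Perturbation of strongly regular generalized equations -/

/-- Robinson's implicit function theorem: a strongly regular solution of a generalized equation
persists, and depends Lipschitz continuously on the single-valued part, under perturbations which
are small together with their Lipschitz moduli. -/
theorem StronglyRegular.exists_stable {E : Type*} [NormedAddCommGroup E] [NormedSpace ℝ E]
    [CompleteSpace E] {φ₀ : E → E} {N : E → Set E} {z₀ : E}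
    (h : StronglyRegular φ₀ N z₀) (hd : HasStrictFDerivAt φ₀ (fderiv ℝ φ₀ z₀) z₀)
    {U : Set E} (hU : U ∈ 𝓝 z₀) :
    ∃ V ∈ 𝓝 z₀, V ⊆ U ∧ ∃ ε > 0, ∃ κ > 0,
      (∀ φ : E → E, (∀ x ∈ V, ∀ y ∈ V, ‖(φ x - φ₀ x) - (φ y - φ₀ y)‖ ≤ ε * ‖x - y‖) →
        ‖φ z₀ - φ₀ z₀‖ ≤ ε → ∃ z, geSolutions φ N ∩ V = {z}) ∧
      ∀ φ ψ : E → E, (∀ x ∈ V, ∀ y ∈ V, ‖(φ x - φ₀ x) - (φ y - φ₀ y)‖ ≤ ε * ‖x - y‖) →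
        ‖φ z₀ - φ₀ z₀‖ ≤ ε →
        (∀ x ∈ V, ∀ y ∈ V, ‖(ψ x - φ₀ x) - (ψ y - φ₀ y)‖ ≤ ε * ‖x - y‖) →
        ‖ψ z₀ - φ₀ z₀‖ ≤ ε →
        ∀ x ∈ geSolutions φ N ∩ V, ∀ y ∈ geSolutions ψ N ∩ V, ‖x - y‖ ≤ κ * ‖φ y - ψ y‖ := by
  obtain ⟨⟨w₀, hw₀, hw₀'⟩, VZ, hVZ, VW, hVW, ζ, c, hζ, hc⟩ := h
  set A := fderiv ℝ φ₀ z₀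
  -- The Lipschitz constant `c` may vanish, while `C` is going to be divided by.
  obtain ⟨C, hC, hC0⟩ : ∃ C : ℝ, (c : ℝ) ≤ C ∧ 0 < C := ⟨c + 1, by linarith, by positivity⟩
  have hζlip : ∀ a ∈ VW, ∀ b ∈ VW, ‖ζ a - ζ b‖ ≤ C * ‖a - b‖ := fun a ha b hb => by
    have := hc.dist_le_mul a ha b hb
    rw [dist_eq_norm, dist_eq_norm] at this
    exact this.trans (by gcongr)
  have hζ0 : ζ 0 = z₀ := by
    have : z₀ ∈ ({ζ 0} : Set E) := by
      rw [← hζ 0 (mem_of_mem_nhds hVW)]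
      exact ⟨mem_of_mem_nhds hVZ, w₀, hw₀, by simpa using hw₀'⟩
    exact (mem_singleton_iff.1 this).symm
  -- Linearization error and perturbation each contribute a modulus `1/(4C)` to the residual.
  -- Composed with `ζ`, which is `C`-Lipschitz, the residual then gives a contraction of ratio
  -- `1/2`.
  obtain ⟨s, hs, hsA⟩ := hd.approximates_deriv_on_nhds
    (c := (1 / (4 * C)).toNNReal) (Or.inr (Real.toNNReal_pos.2 (by positivity)))
  obtain ⟨σ, hσ, hσW⟩ := Metric.mem_nhds_iff.1 hVW
  obtain ⟨ρ₀, hρ₀, hρ₀s⟩ := Metric.nhds_basis_closedBall.mem_iff.1 (inter_mem (inter_mem hU hs) hVZ)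
  -- The bounds `ρ ≤ σC/2` and `ε ≤ σ/4` keep the residual below `σ/2`, hence in the domain `VW` of
  -- `ζ`; `ε ≤ ρ/(4C)` makes the fixed-point map send the ball into the smaller ball of radius
  -- `3ρ/4`.
  obtain ⟨ρ, hρ, hρρ₀, hρσ⟩ : ∃ ρ : ℝ, 0 < ρ ∧ ρ ≤ ρ₀ ∧ ρ ≤ σ * C / 2 :=
    ⟨min ρ₀ (σ * C / 2), by positivity, min_le_left _ _, min_le_right _ _⟩
  obtain ⟨ε, hε, hε1, hε2, hε3⟩ : ∃ ε : ℝ, 0 < ε ∧ ε ≤ 1 / (4 * C) ∧ ε ≤ σ / 4 ∧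
      ε ≤ ρ / (4 * C) :=
    ⟨min (1 / (4 * C)) (min (σ / 4) (ρ / (4 * C))), by positivity, min_le_left _ _,
      (min_le_right _ _).trans (min_le_left _ _), (min_le_right _ _).trans (min_le_right _ _)⟩
  have hVs : Metric.closedBall z₀ ρ ⊆ (U ∩ s) ∩ VZ :=
    (Metric.closedBall_subset_closedBall hρρ₀).trans hρ₀s
  have hz₀ : z₀ ∈ Metric.closedBall z₀ ρ := Metric.mem_closedBall_self hρ.le
  set V := Metric.closedBall z₀ ρ with hV
  -- the residual of the linearization
  let r : (E → E) → E → E := fun φ z => φ₀ z₀ + A (z - z₀) - φ z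
  have hrlip : ∀ φ : E → E, (∀ x ∈ V, ∀ y ∈ V, ‖(φ x - φ₀ x) - (φ y - φ₀ y)‖ ≤ ε * ‖x - y‖) →
      ∀ x ∈ V, ∀ y ∈ V, ‖r φ x - r φ y‖ ≤ 1 / (2 * C) * ‖x - y‖ := by
    intro φ hφ x hx y hy
    have h1 : ‖φ₀ x - φ₀ y - A (x - y)‖ ≤ 1 / (4 * C) * ‖x - y‖ := by
      have := hsA x (hVs hx).1.2 y (hVs hy).1.2
      rwa [Real.coe_toNNReal _ (by positivity)] at this
    have h2 := hφ x hx y hy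
    have e : r φ x - r φ y = -(φ₀ x - φ₀ y - A (x - y)) - ((φ x - φ₀ x) - (φ y - φ₀ y)) := by
      simp only [r, map_sub]; abel
    rw [e]
    calc _ ≤ ‖-(φ₀ x - φ₀ y - A (x - y))‖ + ‖(φ x - φ₀ x) - (φ y - φ₀ y)‖ := norm_sub_le _ _
      _ ≤ 1 / (4 * C) * ‖x - y‖ + 1 / (4 * C) * ‖x - y‖ := by
          rw [norm_neg]; gcongr; exact h2.trans (by gcongr)
      _ = _ := by field_simp; ring
  have hrz₀ : ∀ φ : E → E, ‖φ z₀ - φ₀ z₀‖ ≤ ε → ‖r φ z₀‖ ≤ ε := fun φ hφ => by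
    simpa [r, norm_sub_rev] using hφ
  have hrbd : ∀ φ : E → E, (∀ x ∈ V, ∀ y ∈ V, ‖(φ x - φ₀ x) - (φ y - φ₀ y)‖ ≤ ε * ‖x - y‖) →
      ‖φ z₀ - φ₀ z₀‖ ≤ ε → ∀ x ∈ V, ‖r φ x‖ ≤ 1 / (2 * C) * ρ + ε := by
    intro φ hφ hφ0 x hx
    have h1 := hrlip φ hφ x hx z₀ hz₀
    have h2 := hrz₀ φ hφ0
    have h3 : ‖x - z₀‖ ≤ ρ := by rwa [← dist_eq_norm]
    calc ‖r φ x‖ = ‖(r φ x - r φ z₀) + r φ z₀‖ := by congr 1; abel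
      _ ≤ _ := norm_add_le _ _
      _ ≤ _ := add_le_add (h1.trans (by gcongr)) h2
  have hrW : ∀ φ : E → E, (∀ x ∈ V, ∀ y ∈ V, ‖(φ x - φ₀ x) - (φ y - φ₀ y)‖ ≤ ε * ‖x - y‖) →
      ‖φ z₀ - φ₀ z₀‖ ≤ ε → ∀ x ∈ V, r φ x ∈ VW := by
    intro φ hφ hφ0 x hx
    refine hσW (mem_ball_zero_iff.2 ((hrbd φ hφ hφ0 x hx).trans_lt ?_))
    have : 1 / (2 * C) * ρ ≤ 1 / (2 * C) * (σ * C / 2) := by gcongr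
    have e : 1 / (2 * C) * (σ * C / 2) = σ / 4 := by field_simp; ring
    linarith
  -- Moving the residual to the right-hand side turns the perturbed equation into the linearized one
  -- with `δ = r φ x`, so its solutions in `V` are the fixed points of `ζ ∘ r φ`.
  have hsol : ∀ φ : E → E, (∀ x ∈ V, ∀ y ∈ V, ‖(φ x - φ₀ x) - (φ y - φ₀ y)‖ ≤ ε * ‖x - y‖) →
      ‖φ z₀ - φ₀ z₀‖ ≤ ε → ∀ x ∈ V, (x ∈ geSolutions φ N ↔ x = ζ (r φ x)) := by
    intro φ hφ hφ0 x hx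
    have key := hζ _ (hrW φ hφ hφ0 x hx)
    rw [← mem_singleton_iff, ← key]
    constructor
    · rintro ⟨w, hw, hw'⟩
      refine ⟨(hVs hx).2, w, hw, ?_⟩
      rw [eq_neg_of_add_eq_zero_right hw']; simp only [r]; abel
    · rintro ⟨-, w, hw, hw'⟩
      refine ⟨w, hw, ?_⟩
      have : w = - φ x := by
        have : w = (φ₀ z₀ + A (x - z₀) + w) - (φ₀ z₀ + A (x - z₀)) := by abel
        rw [this, hw']; simp only [r]; abel
      rw [this]; abel
  have hstab : ∀ φ ψ : E → E, (∀ x ∈ V, ∀ y ∈ V, ‖(φ x - φ₀ x) - (φ y - φ₀ y)‖ ≤ ε * ‖x - y‖) →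
        ‖φ z₀ - φ₀ z₀‖ ≤ ε →
        (∀ x ∈ V, ∀ y ∈ V, ‖(ψ x - φ₀ x) - (ψ y - φ₀ y)‖ ≤ ε * ‖x - y‖) →
        ‖ψ z₀ - φ₀ z₀‖ ≤ ε →
        ∀ x ∈ geSolutions φ N ∩ V, ∀ y ∈ geSolutions ψ N ∩ V,
          ‖x - y‖ ≤ (2 * C) * ‖φ y - ψ y‖ := by
    rintro φ ψ hφ hφ0 hψ hψ0 x ⟨hx, hxV⟩ y ⟨hy, hyV⟩
    have ex := (hsol φ hφ hφ0 x hxV).1 hx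
    have ey := (hsol ψ hψ hψ0 y hyV).1 hy
    have h1 := hζlip _ (hrW φ hφ hφ0 x hxV) _ (hrW ψ hψ hψ0 y hyV)
    rw [← ex, ← ey] at h1
    have h2 : ‖r φ x - r ψ y‖ ≤ 1 / (2 * C) * ‖x - y‖ + ‖φ y - ψ y‖ := by
      calc ‖r φ x - r ψ y‖ = ‖(r φ x - r φ y) + (r φ y - r ψ y)‖ := by congr 1; abel
        _ ≤ _ := norm_add_le _ _
        _ ≤ _ := by
          gcongr
          · exact hrlip φ hφ x hxV y hyV
          · rw [norm_sub_rev]; apply le_of_eq; simp only [r]; congr 1; abel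
    -- Half of `‖x - y‖` reappears on the right and is absorbed, whence the factor `2 * C`.
    have h3 : C * ‖r φ x - r ψ y‖ ≤ C * (1 / (2 * C) * ‖x - y‖ + ‖φ y - ψ y‖) := by gcongr
    have e : C * (1 / (2 * C) * ‖x - y‖ + ‖φ y - ψ y‖) = ‖x - y‖ / 2 + C * ‖φ y - ψ y‖ := by
      field_simp
    linarith
  refine ⟨V, Metric.closedBall_mem_nhds _ hρ, fun x hx => (hVs hx).1.1, ε, hε, 2 * C,
    by positivity, fun φ hφ hφ0 => ?_, hstab⟩
  have hmaps : MapsTo (fun z => ζ (r φ z)) V V := by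
    intro x hx
    have h1 := hζlip _ (hrW φ hφ hφ0 x hx) 0 (mem_of_mem_nhds hVW)
    rw [hζ0, sub_zero] at h1
    rw [hV, Metric.mem_closedBall, dist_eq_norm]
    have h2 := hrbd φ hφ hφ0 x hx
    have h3 : C * ‖r φ x‖ ≤ C * (1 / (2 * C) * ρ + ρ / (4 * C)) := by gcongr; linarith
    have e : C * (1 / (2 * C) * ρ + ρ / (4 * C)) = ρ / 2 + ρ / 4 := by field_simp
    linarith
  have hcontr : ContractingWith (1 / 2) (hmaps.restrict _ V V) := by
    refine ⟨by norm_num, LipschitzWith.of_dist_le_mul fun x y => ?_⟩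
    have h1 := hζlip _ (hrW φ hφ hφ0 x x.2) _ (hrW φ hφ hφ0 y y.2)
    have h2 := hrlip φ hφ x x.2 y y.2
    rw [Subtype.dist_eq, Subtype.dist_eq, dist_eq_norm, dist_eq_norm]
    calc _ ≤ C * (1 / (2 * C) * ‖(x : E) - y‖) := h1.trans (by gcongr)
      _ = _ := by push_cast; field_simp
  obtain ⟨z, hzV, hz, -⟩ := hcontr.exists_fixedPoint' Metric.isClosed_closedBall.isComplete
    hmaps hz₀ (edist_ne_top _ _)
  have hzsol : z ∈ geSolutions φ N := (hsol φ hφ hφ0 z hzV).2 hz.symm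
  refine ⟨z, Subset.antisymm (fun y hy => ?_) (singleton_subset_iff.2 ⟨hzsol, hzV⟩)⟩
  -- Uniqueness is the stability estimate for two equal perturbations.
  have := hstab φ φ hφ hφ0 hφ hφ0 y hy z ⟨hzsol, hzV⟩
  rw [sub_self, norm_zero, mul_zero] at this
  exact sub_eq_zero.1 (norm_le_zero_iff.1 this)

/-! ### The Kantorovich metric on measures with finite first moment -/

section Prob

variable {k : ℕ} {Ξ : Set (EuclideanSpace ℝ (Fin k))}
  {P Q R : ProbabilityMeasure (EuclideanSpace ℝ (Fin k))}

theorem ae_mem_of_mem_probOn (hQ : Q ∈ probOn Ξ) :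
    ∀ᵐ ξ ∂(Q : Measure (EuclideanSpace ℝ (Fin k))), ξ ∈ Ξ := by
  rw [ae_iff]; exact hQ

theorem nonempty_of_mem_probOn (hQ : Q ∈ probOn Ξ) : Ξ.Nonempty :=
  (ae_mem_of_mem_probOn hQ).exists

theorem aestronglyMeasurable_of_continuousOn {G : Type*} [NormedAddCommGroup G]
    (hΞ : IsClosed Ξ) (hQ : Q ∈ probOn Ξ) {φ : EuclideanSpace ℝ (Fin k) → G}
    (hφ : ContinuousOn φ Ξ) :
    AEStronglyMeasurable φ (Q : Measure (EuclideanSpace ℝ (Fin k))) := by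
  rw [← Measure.restrict_eq_self_of_ae_mem (ae_mem_of_mem_probOn hQ)]
  exact hφ.aestronglyMeasurable hΞ.measurableSet

theorem integrable_norm_of_mem_finiteMoment (hQ : Q ∈ finiteMoment Ξ) :
    Integrable (fun ξ => ‖ξ‖) (Q : Measure (EuclideanSpace ℝ (Fin k))) :=
  (show Integrable (fun ξ => ξ) (Q : Measure (EuclideanSpace ℝ (Fin k))) from
    ⟨measurable_id.aestronglyMeasurable, hQ.2⟩).norm

theorem integrable_of_lipschitzOnWith {G : Type*} [NormedAddCommGroup G]
    (hΞ : IsClosed Ξ) (hQ : Q ∈ finiteMoment Ξ) {φ : EuclideanSpace ℝ (Fin k) → G} {K : ℝ≥0}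
    (hφ : LipschitzOnWith K φ Ξ) :
    Integrable φ (Q : Measure (EuclideanSpace ℝ (Fin k))) := by
  obtain ⟨ξ₀, hξ₀⟩ := nonempty_of_mem_probOn hQ.1
  refine Integrable.mono' (g := fun ξ => ‖φ ξ₀‖ + K * (‖ξ‖ + ‖ξ₀‖))
    ((integrable_const _).add (((integrable_norm_of_mem_finiteMoment hQ).add
      (integrable_const _)).const_mul _))
    (aestronglyMeasurable_of_continuousOn hΞ hQ.1 hφ.continuousOn) ?_
  filter_upwards [ae_mem_of_mem_probOn hQ.1] with ξ hξ
  have h := hφ.dist_le_mul ξ hξ ξ₀ hξ₀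
  rw [dist_eq_norm, dist_eq_norm] at h
  calc ‖φ ξ‖ = ‖φ ξ₀ + (φ ξ - φ ξ₀)‖ := by congr 1; abel
    _ ≤ ‖φ ξ₀‖ + ‖φ ξ - φ ξ₀‖ := norm_add_le _ _
    _ ≤ ‖φ ξ₀‖ + K * (‖ξ‖ + ‖ξ₀‖) := by
      gcongr; exact h.trans (by gcongr; exact norm_sub_le _ _)

theorem integrable_of_lipschitzWith {G : Type*} [NormedAddCommGroup G]
    (hQ : Q ∈ finiteMoment Ξ) {φ : EuclideanSpace ℝ (Fin k) → G} {K : ℝ≥0}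
    (hφ : LipschitzWith K φ) :
    Integrable φ (Q : Measure (EuclideanSpace ℝ (Fin k))) :=
  integrable_of_lipschitzOnWith isClosed_univ
    (show Q ∈ finiteMoment univ from ⟨by simp [probOn], hQ.2⟩) hφ.lipschitzOnWith

/-- Subtracting `φ 0` costs nothing between probability measures, and `|φ ξ - φ 0| ≤ ‖ξ‖`. The bound
does not depend on `φ`, so the real supremum defining `dK` is a genuine one. -/
theorem abs_integral_sub_le_moments (hP : P ∈ finiteMoment Ξ) (hQ : Q ∈ finiteMoment Ξ)
    {φ : EuclideanSpace ℝ (Fin k) → ℝ} (hφ : LipschitzWith 1 φ) :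
    |∫ ξ, φ ξ ∂(P : Measure (EuclideanSpace ℝ (Fin k)))
        - ∫ ξ, φ ξ ∂(Q : Measure (EuclideanSpace ℝ (Fin k)))|
      ≤ (∫ ξ, ‖ξ‖ ∂(P : Measure (EuclideanSpace ℝ (Fin k))))
        + ∫ ξ, ‖ξ‖ ∂(Q : Measure (EuclideanSpace ℝ (Fin k))) := by
  have key : ∀ R ∈ finiteMoment Ξ, |∫ ξ, φ ξ ∂(R : Measure (EuclideanSpace ℝ (Fin k))) - φ 0|
      ≤ ∫ ξ, ‖ξ‖ ∂(R : Measure (EuclideanSpace ℝ (Fin k))) := by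
    intro R hR
    have : ∫ ξ, (φ ξ - φ 0) ∂(R : Measure (EuclideanSpace ℝ (Fin k)))
        = ∫ ξ, φ ξ ∂(R : Measure (EuclideanSpace ℝ (Fin k))) - φ 0 := by
      rw [integral_sub (integrable_of_lipschitzWith hR hφ) (integrable_const _)]; simp
    rw [← this, ← Real.norm_eq_abs]
    refine norm_integral_le_of_norm_le (integrable_norm_of_mem_finiteMoment hR)
      (ae_of_all _ fun ξ => ?_)
    simpa [dist_eq_norm] using hφ.dist_le_mul ξ 0
  have h1 := abs_le.1 (key P hP)
  have h2 := abs_le.1 (key Q hQ)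
  exact abs_le.2 ⟨by linarith, by linarith⟩

theorem abs_integral_sub_le_dK (hP : P ∈ finiteMoment Ξ) (hQ : Q ∈ finiteMoment Ξ)
    {φ : EuclideanSpace ℝ (Fin k) → ℝ} (hφ : LipschitzWith 1 φ) :
    |∫ ξ, φ ξ ∂(P : Measure (EuclideanSpace ℝ (Fin k)))
        - ∫ ξ, φ ξ ∂(Q : Measure (EuclideanSpace ℝ (Fin k)))| ≤ dK P Q := by
  have hb : BddAbove (range fun φ : {φ : EuclideanSpace ℝ (Fin k) → ℝ // LipschitzWith 1 φ} =>
      |∫ ξ, φ.1 ξ ∂(P : Measure (EuclideanSpace ℝ (Fin k)))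
        - ∫ ξ, φ.1 ξ ∂(Q : Measure (EuclideanSpace ℝ (Fin k)))|) :=
    ⟨(∫ ξ, ‖ξ‖ ∂(P : Measure (EuclideanSpace ℝ (Fin k))))
        + ∫ ξ, ‖ξ‖ ∂(Q : Measure (EuclideanSpace ℝ (Fin k))),
      forall_mem_range.2 fun ψ => abs_integral_sub_le_moments hP hQ ψ.2⟩
  exact le_ciSup hb ⟨φ, hφ⟩

theorem dK_le {a : ℝ} (h : ∀ φ : EuclideanSpace ℝ (Fin k) → ℝ, LipschitzWith 1 φ →
      |∫ ξ, φ ξ ∂(P : Measure (EuclideanSpace ℝ (Fin k)))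
        - ∫ ξ, φ ξ ∂(Q : Measure (EuclideanSpace ℝ (Fin k)))| ≤ a) : dK P Q ≤ a := by
  have : Nonempty {φ : EuclideanSpace ℝ (Fin k) → ℝ // LipschitzWith 1 φ} :=
    ⟨⟨fun _ => 0, LipschitzWith.const' 0⟩⟩
  exact ciSup_le fun φ => h φ.1 φ.2

theorem dK_nonneg : 0 ≤ dK P Q := Real.iSup_nonneg fun _ => abs_nonneg _

theorem dK_self : dK P P = 0 := by simp [dK]

theorem dK_triangle (hP : P ∈ finiteMoment Ξ) (hQ : Q ∈ finiteMoment Ξ)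
    (hR : R ∈ finiteMoment Ξ) : dK P R ≤ dK P Q + dK Q R :=
  dK_le fun _ hφ => (abs_sub_le _ _ _).trans
    (add_le_add (abs_integral_sub_le_dK hP hQ hφ) (abs_integral_sub_le_dK hQ hR hφ))

theorem abs_integral_sub_le_mul_dK (hP : P ∈ finiteMoment Ξ) (hQ : Q ∈ finiteMoment Ξ)
    {φ : EuclideanSpace ℝ (Fin k) → ℝ} {K : ℝ≥0} (hφ : LipschitzOnWith K φ Ξ) :
    |∫ ξ, φ ξ ∂(P : Measure (EuclideanSpace ℝ (Fin k)))
        - ∫ ξ, φ ξ ∂(Q : Measure (EuclideanSpace ℝ (Fin k)))| ≤ K * dK P Q := by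
  -- The test functions of `dK` live on the whole space. The extension keeps the constant `K`, and
  -- the integrals see only `Ξ`.
  obtain ⟨g, hg, hgφ⟩ := hφ.extend_real
  have e : ∀ R ∈ finiteMoment Ξ, ∫ ξ, φ ξ ∂(R : Measure (EuclideanSpace ℝ (Fin k)))
      = ∫ ξ, g ξ ∂(R : Measure (EuclideanSpace ℝ (Fin k))) := fun R hR =>
    integral_congr_ae ((ae_mem_of_mem_probOn hR.1).mono hgφ)
  rw [e P hP, e Q hQ]
  rcases eq_or_ne K 0 with rfl | hK
  · have : ∀ ξ, g ξ = g 0 := fun ξ => by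
      simpa using hg.dist_le_mul ξ 0
    simp [this]
  · have hK' : (0 : ℝ) < K := NNReal.coe_pos.2 (pos_iff_ne_zero.2 hK)
    have h1 : LipschitzWith 1 fun ξ => (K : ℝ)⁻¹ * g ξ := by
      refine LipschitzWith.of_dist_le_mul fun x y => ?_
      have := hg.dist_le_mul x y
      rw [Real.dist_eq] at this ⊢
      rw [← mul_sub, abs_mul, abs_of_pos (inv_pos.2 hK'), inv_mul_le_iff₀ hK']
      simpa using this
    have h2 := abs_integral_sub_le_dK hP hQ h1
    rwa [integral_const_mul, integral_const_mul, ← mul_sub, abs_mul, abs_of_pos (inv_pos.2 hK'),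
      inv_mul_le_iff₀ hK'] at h2

/-- The vector case reduces to the scalar one by pairing `φ` with the difference `v` of the two
integrals, which yields `‖v‖² ≤ ‖v‖ K dK P Q`; no dimensional constant is lost. -/
theorem norm_integral_sub_le_mul_dK {G : Type*} [NormedAddCommGroup G] [InnerProductSpace ℝ G]
    [CompleteSpace G] (hΞ : IsClosed Ξ) (hP : P ∈ finiteMoment Ξ) (hQ : Q ∈ finiteMoment Ξ)
    {φ : EuclideanSpace ℝ (Fin k) → G} {K : ℝ≥0} (hφ : LipschitzOnWith K φ Ξ) :
    ‖∫ ξ, φ ξ ∂(P : Measure (EuclideanSpace ℝ (Fin k)))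
        - ∫ ξ, φ ξ ∂(Q : Measure (EuclideanSpace ℝ (Fin k)))‖ ≤ K * dK P Q := by
  set v := ∫ ξ, φ ξ ∂(P : Measure (EuclideanSpace ℝ (Fin k)))
        - ∫ ξ, φ ξ ∂(Q : Measure (EuclideanSpace ℝ (Fin k))) with hv
  rcases eq_or_ne v 0 with h0 | h0
  · rw [h0, norm_zero]; exact mul_nonneg K.2 dK_nonneg
  have hlip : LipschitzOnWith (‖v‖₊ * K) (fun ξ => inner ℝ v (φ ξ)) Ξ := by
    refine LipschitzOnWith.of_dist_le_mul fun x hx y hy => ?_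
    have := hφ.dist_le_mul x hx y hy
    rw [dist_eq_norm] at this
    rw [Real.dist_eq, ← inner_sub_right]
    calc _ ≤ ‖v‖ * ‖φ x - φ y‖ := abs_real_inner_le_norm _ _
      _ ≤ ‖v‖ * (K * dist x y) := by gcongr
      _ = _ := by push_cast; ring
  have h1 := abs_integral_sub_le_mul_dK hP hQ hlip
  rw [integral_inner (integrable_of_lipschitzOnWith hΞ hP hφ),
    integral_inner (integrable_of_lipschitzOnWith hΞ hQ hφ), ← inner_sub_right, ← hv,
    real_inner_self_eq_norm_sq, abs_of_nonneg (sq_nonneg _)] at h1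
  push_cast at h1
  have hpos : 0 < ‖v‖ := norm_pos_iff.2 h0
  refine le_of_mul_le_mul_left ?_ hpos
  calc ‖v‖ * ‖v‖ = ‖v‖ ^ 2 := by ring
    _ ≤ _ := h1
    _ = _ := by ring

end Prob

/-! ### Compactness and convexity of sets of measures with bounded moments -/

section Moment

variable {k : ℕ} {Ξ : Set (EuclideanSpace ℝ (Fin k))} {γ M₀ : ℝ}
  {P Q : ProbabilityMeasure (EuclideanSpace ℝ (Fin k))}

theorem enorm_rpow_eq_ofReal {G : Type*} [NormedAddCommGroup G] (hγ : 0 ≤ γ) (x : G) :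
    ‖x‖ₑ ^ γ = ENNReal.ofReal (‖x‖ ^ γ) := by
  rw [← ofReal_norm, ENNReal.ofReal_rpow_of_nonneg (norm_nonneg _) hγ]

theorem boundedMoment_subset_finiteMoment (hγ : 1 < γ) :
    boundedMoment Ξ γ M₀ ⊆ finiteMoment Ξ := by
  intro Q hQ
  refine ⟨hQ.1, ?_⟩
  have h : ∀ ξ : EuclideanSpace ℝ (Fin k), ‖ξ‖ₑ ≤ 1 + ‖ξ‖ₑ ^ γ := fun ξ => by
    rcases le_total ‖ξ‖ₑ 1 with h | h
    · exact h.trans le_self_add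
    · calc ‖ξ‖ₑ = ‖ξ‖ₑ ^ (1 : ℝ) := by simp
        _ ≤ ‖ξ‖ₑ ^ γ := ENNReal.rpow_le_rpow_of_exponent_le h hγ.le
        _ ≤ _ := le_add_self
  calc _ ≤ ∫⁻ ξ, (1 + ‖ξ‖ₑ ^ γ) ∂(Q : Measure (EuclideanSpace ℝ (Fin k))) := lintegral_mono h
    _ = 1 + ∫⁻ ξ, ‖ξ‖ₑ ^ γ ∂(Q : Measure (EuclideanSpace ℝ (Fin k))) := by
      rw [lintegral_add_left measurable_const]; simp
    _ < ∞ := ENNReal.add_lt_top.2 ⟨ENNReal.one_lt_top, hQ.2.trans_lt ENNReal.ofReal_lt_top⟩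

theorem integrable_norm_rpow_of_mem_boundedMoment (hγ : 1 < γ) (hQ : Q ∈ boundedMoment Ξ γ M₀) :
    Integrable (fun ξ => ‖ξ‖ ^ γ) (Q : Measure (EuclideanSpace ℝ (Fin k))) := by
  have hγ0 : 0 ≤ γ := by linarith
  refine ⟨by fun_prop, ?_⟩
  rw [hasFiniteIntegral_iff_ofReal (ae_of_all _ fun ξ => by positivity)]
  simp_rw [← enorm_rpow_eq_ofReal hγ0]
  exact hQ.2.trans_lt ENNReal.ofReal_lt_top

theorem integral_norm_rpow_le_of_mem_boundedMoment (hγ : 1 < γ) (hM : 0 ≤ M₀)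
    (hQ : Q ∈ boundedMoment Ξ γ M₀) :
    ∫ ξ, ‖ξ‖ ^ γ ∂(Q : Measure (EuclideanSpace ℝ (Fin k))) ≤ M₀ := by
  have hγ0 : 0 ≤ γ := by linarith
  rw [integral_eq_lintegral_of_nonneg_ae (ae_of_all _ fun ξ => by positivity) (by fun_prop)]
  refine ENNReal.toReal_le_of_le_ofReal hM ?_
  simp_rw [← enorm_rpow_eq_ofReal hγ0]
  exact hQ.2

/-- By Markov's inequality the mass outside the ball of radius `r` is at most `M₀ / r ^ γ`,
uniformly over the set. -/
theorem isTightMeasureSet_boundedMoment (hγ : 1 < γ) :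
    IsTightMeasureSet {((μ : ProbabilityMeasure (EuclideanSpace ℝ (Fin k))) :
      Measure (EuclideanSpace ℝ (Fin k))) | μ ∈ boundedMoment Ξ γ M₀} := by
  have hγ0 : 0 < γ := by linarith
  refine isTightMeasureSet_of_tendsto_measure_norm_gt ?_
  have hlim : Tendsto (fun r : ℝ => ENNReal.ofReal M₀ / ENNReal.ofReal (r ^ γ)) atTop (𝓝 0) := by
    have := ENNReal.Tendsto.const_div
      (ENNReal.tendsto_ofReal_atTop.comp (tendsto_rpow_atTop hγ0))
      (Or.inr (ENNReal.ofReal_ne_top (r := M₀)))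
    simpa using this
  refine tendsto_of_tendsto_of_tendsto_of_le_of_le' tendsto_const_nhds hlim
    (Eventually.of_forall fun _ => zero_le) ?_
  filter_upwards [eventually_gt_atTop 0] with r hr
  refine iSup₂_le ?_
  rintro _ ⟨μ, hμ, rfl⟩
  have hpos : 0 < r ^ γ := Real.rpow_pos_of_pos hr _
  rw [ENNReal.le_div_iff_mul_le (Or.inl (ENNReal.ofReal_pos.2 hpos).ne')
    (Or.inl ENNReal.ofReal_ne_top), mul_comm]
  have hsub : {ξ : EuclideanSpace ℝ (Fin k) | r < ‖ξ‖}
      ⊆ {ξ | ENNReal.ofReal (r ^ γ) ≤ ‖ξ‖ₑ ^ γ} := by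
    intro ξ hξ
    rw [mem_ofPred_eq] at hξ
    rw [mem_ofPred_eq, enorm_rpow_eq_ofReal hγ0.le]
    gcongr
  have hmeas : Measurable fun ξ : EuclideanSpace ℝ (Fin k) => ‖ξ‖ₑ ^ γ := by fun_prop
  calc _ ≤ ENNReal.ofReal (r ^ γ) * (μ : Measure (EuclideanSpace ℝ (Fin k)))
        {ξ | ENNReal.ofReal (r ^ γ) ≤ ‖ξ‖ₑ ^ γ} := by gcongr
    _ ≤ _ := mul_meas_ge_le_lintegral hmeas _
    _ ≤ _ := hμ.2

/-- Both conditions are lower semicontinuous for weak convergence, by the portmanteau inequality for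
open sets: the complement of `Ξ` is open, and the moment is the integral of a nonnegative continuous
function. -/
theorem mem_boundedMoment_of_tendsto (hΞ : IsClosed Ξ) (hγ : 1 < γ)
    {u : ℕ → ProbabilityMeasure (EuclideanSpace ℝ (Fin k))}
    (hu : ∀ n, u n ∈ boundedMoment Ξ γ M₀) (hlim : Tendsto u atTop (𝓝 Q)) :
    Q ∈ boundedMoment Ξ γ M₀ := by
  have hγ0 : 0 ≤ γ := by linarith
  have hopen := fun (G : Set (EuclideanSpace ℝ (Fin k))) (hG : IsOpen G) =>
    ProbabilityMeasure.le_liminf_measure_open_of_tendsto hlim hG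
  constructor
  · have := hopen _ hΞ.isOpen_compl
    have h0 : ∀ n, (u n : Measure (EuclideanSpace ℝ (Fin k))) Ξᶜ = 0 := fun n => (hu n).1
    simp only [h0, liminf_const] at this
    exact le_antisymm this zero_le
  · have := lintegral_le_liminf_lintegral_of_forall_isOpen_measure_le_liminf_measure
      (f := fun ξ : EuclideanSpace ℝ (Fin k) => ‖ξ‖ ^ γ)
      (continuous_norm.rpow_const fun _ => Or.inr hγ0) (fun ξ => by positivity) hopen
    simp_rw [← enorm_rpow_eq_ofReal hγ0] at this
    refine this.trans (liminf_le_of_frequently_le' (Frequently.of_forall fun n => (hu n).2))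

open BoundedContinuousFunction in
-- The layer-cake formula compares the superlevel sets of `f` under `μ` with their `ε`-thickenings
-- under `ν`. As `f` is 1-Lipschitz, these thickenings lie in superlevel sets of `f + ε`, so the
-- thickening costs `ε`, in addition to the `ε * ‖f‖` from the distance itself.
theorem integral_le_of_levyProkhorovEDist_lt_of_lipschitzWith {Ω : Type*} [PseudoMetricSpace Ω]
    [MeasurableSpace Ω] [OpensMeasurableSpace Ω] {μ ν : Measure Ω} [IsProbabilityMeasure μ]
    [IsProbabilityMeasure ν] {ε : ℝ} (hε : 0 < ε)
    (h : levyProkhorovEDist μ ν < ENNReal.ofReal ε) {f : Ω →ᵇ ℝ} (hf : LipschitzWith 1 f)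
    (hf0 : 0 ≤ ⇑f) : ∫ x, f x ∂μ ≤ ∫ x, f x ∂ν + ε * (1 + ‖f‖) := by
  have h1 := f.integral_le_of_levyProkhorovEDist_lt μ ν hε h (ae_of_all _ hf0)
  have hsub : ∀ t, Metric.thickening ε {a | t ≤ f a} ⊆ {a | t ≤ f a + ε} := by
    intro t x hx
    obtain ⟨y, hy, hxy⟩ := Metric.mem_thickening_iff.1 hx
    have h2 := (hf.dist_le_mul y x)
    rw [Real.dist_eq, dist_comm] at h2
    have h3 := (abs_le.1 h2).2
    simp only [NNReal.coe_one, one_mul, mem_ofPred_eq] at *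
    linarith
  have hint : ∫ x, (f x + ε) ∂ν = ∫ t in Ioc 0 (‖f‖ + ε), ν.real {a | t ≤ f a + ε} := by
    refine Integrable.integral_eq_integral_Ioc_meas_le ((f.integrable ν).add (integrable_const _))
      (ae_of_all _ fun x => ?_) (ae_of_all _ fun x => ?_)
    · exact add_nonneg (hf0 x) hε.le
    · exact add_le_add (f.apply_le_norm x) le_rfl
  have intble : ∀ (A : ℝ → Set Ω), (∀ s t, s ≤ t → A t ⊆ A s) → ∀ b,
      IntegrableOn (fun t => ν.real (A t)) (Ioc 0 b) := by
    intro A hA b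
    refine Measure.integrableOn_of_bounded (M := 1) measure_Ioc_lt_top.ne ?_ ?_
    · exact (Measurable.ennreal_toReal (Antitone.measurable
        fun s t hst => measure_mono (hA s t hst))).aestronglyMeasurable
    · exact ae_of_all _ fun t => by
        rw [Real.norm_eq_abs, abs_of_nonneg measureReal_nonneg]; exact measureReal_le_one
  have hmono : ∀ s t : ℝ, s ≤ t → {a | t ≤ f a + ε} ⊆ {a | s ≤ f a + ε} :=
    fun s t hst a ha => hst.trans ha
  have h2 : ∫ t in Ioc 0 ‖f‖, ν.real (Metric.thickening ε {a | t ≤ f a})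
      ≤ ∫ t in Ioc 0 (‖f‖ + ε), ν.real {a | t ≤ f a + ε} := by
    calc _ ≤ ∫ t in Ioc 0 ‖f‖, ν.real {a | t ≤ f a + ε} :=
          setIntegral_mono
            (intble (fun t => Metric.thickening ε {a | t ≤ f a})
              (fun s t hst => Metric.thickening_subset_of_subset _ fun a ha => hst.trans ha) _)
            (intble (fun t => {a | t ≤ f a + ε}) hmono _) fun t => measureReal_mono (hsub t)
      _ ≤ _ := by
          refine setIntegral_mono_set (intble (fun t => {a | t ≤ f a + ε}) hmono _)
            (ae_of_all _ fun t => ?_) (ae_of_all _ fun t ht => ?_)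
          · exact measureReal_nonneg
          · exact Ioc_subset_Ioc_right (by linarith) ht
  rw [← hint, integral_add (f.integrable ν) (integrable_const _)] at h2
  simp only [integral_const, probReal_univ, smul_eq_mul, one_mul] at h2
  linarith

open BoundedContinuousFunction in
-- Test functions are unbounded, so they are truncated at level `r`. The bounded part is controlled
-- by the Lévy–Prokhorov distance, and the tail by the moment, with a factor `r ^ (1 - γ)` that
-- tends to zero because `γ > 1`.
theorem dK_le_of_levyProkhorovEDist_lt (hγ : 1 < γ) (hM : 0 ≤ M₀)
    (hP : P ∈ boundedMoment Ξ γ M₀) (hQ : Q ∈ boundedMoment Ξ γ M₀) {ε r : ℝ} (hε : 0 < ε)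
    (hr : 0 < r) (h : levyProkhorovEDist (P : Measure (EuclideanSpace ℝ (Fin k)))
      (Q : Measure (EuclideanSpace ℝ (Fin k))) < ENNReal.ofReal ε) :
    dK P Q ≤ ε * (1 + 2 * r) + 2 * (r ^ (1 - γ) * M₀) := by
  refine dK_le fun φ hφ => ?_
  -- Shifting by `r` and clamping to `[0, 2r]` gives a nonnegative bounded function that is
  -- unchanged on the ball `‖ξ‖ ≤ r`, where `|φ ξ - φ 0| ≤ r`.
  let g : EuclideanSpace ℝ (Fin k) → ℝ := fun ξ => max (min (φ ξ - φ 0 + r) (2 * r)) 0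
  have hg0 : ∀ ξ, 0 ≤ g ξ := fun ξ => le_max_right _ _
  have hg2 : ∀ ξ, g ξ ≤ 2 * r := fun ξ => max_le (min_le_right _ _) (by linarith)
  have hφ' : LipschitzWith 1 fun ξ => φ ξ - φ 0 + r := by
    refine LipschitzWith.of_dist_le_mul fun x y => ?_
    have := hφ.dist_le_mul x y
    rw [Real.dist_eq] at this ⊢
    convert this using 2; ring
  have hglip : LipschitzWith 1 g := (hφ'.min_const _).max_const _
  let G : EuclideanSpace ℝ (Fin k) →ᵇ ℝ := BoundedContinuousFunction.ofNormedAddCommGroup g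
    hglip.continuous (2 * r) fun ξ => by rw [Real.norm_eq_abs, abs_of_nonneg (hg0 ξ)]; exact hg2 ξ
  have hGn : ‖G‖ ≤ 2 * r := BoundedContinuousFunction.norm_ofNormedAddCommGroup_le _ (by linarith) _
  have hGP := integral_le_of_levyProkhorovEDist_lt_of_lipschitzWith hε h (f := G) hglip hg0
  have hGQ := integral_le_of_levyProkhorovEDist_lt_of_lipschitzWith hε
    (by rw [levyProkhorovEDist_comm]; exact h) (f := G) hglip hg0
  have hGn' : ε * (1 + ‖G‖) ≤ ε * (1 + 2 * r) := by gcongr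
  have hpt : ∀ ξ, |(φ ξ - φ 0 + r) - g ξ| ≤ r ^ (1 - γ) * ‖ξ‖ ^ γ := by
    intro ξ
    have h1 : |φ ξ - φ 0| ≤ ‖ξ‖ := by simpa [Real.dist_eq] using hφ.dist_le_mul ξ 0
    have h1' := abs_le.1 h1
    rcases le_or_gt ‖ξ‖ r with h2 | h2
    · have : g ξ = φ ξ - φ 0 + r := by
        simp only [g]; rw [min_eq_left (by linarith), max_eq_left (by linarith)]
      rw [this, sub_self, abs_zero]; positivity
    · have h3 : ‖ξ‖ ≤ r ^ (1 - γ) * ‖ξ‖ ^ γ := by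
        have hξ : 0 < ‖ξ‖ := hr.trans h2
        calc ‖ξ‖ = ‖ξ‖ ^ (1 - γ) * ‖ξ‖ ^ γ := by
              rw [← Real.rpow_add hξ]; simp
          _ ≤ _ := mul_le_mul_of_nonneg_right
            (Real.rpow_le_rpow_of_nonpos hr h2.le (by linarith)) (by positivity)
      refine le_trans ?_ h3
      simp only [g]
      rcases le_total (φ ξ - φ 0 + r) (2 * r) with h4 | h4
      · rw [min_eq_left h4]
        rcases le_total (φ ξ - φ 0 + r) 0 with h5 | h5
        · rw [max_eq_right h5, abs_le]; constructor <;> linarith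
        · rw [max_eq_left h5]; simp
      · rw [min_eq_right h4, max_eq_left (by linarith), abs_le]; constructor <;> linarith
  have herr : ∀ R ∈ boundedMoment Ξ γ M₀,
      |∫ ξ, φ ξ ∂(R : Measure (EuclideanSpace ℝ (Fin k))) - φ 0 + r
        - ∫ ξ, G ξ ∂(R : Measure (EuclideanSpace ℝ (Fin k)))| ≤ r ^ (1 - γ) * M₀ := by
    intro R hR
    have hφi := integrable_of_lipschitzWith (boundedMoment_subset_finiteMoment hγ hR) hφ
    have e : ∫ ξ, ((φ ξ - φ 0 + r) - G ξ) ∂(R : Measure (EuclideanSpace ℝ (Fin k)))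
        = ∫ ξ, φ ξ ∂(R : Measure (EuclideanSpace ℝ (Fin k))) - φ 0 + r
        - ∫ ξ, G ξ ∂(R : Measure (EuclideanSpace ℝ (Fin k))) := by
      have h1 : Integrable (fun ξ => φ ξ - φ 0) (R : Measure (EuclideanSpace ℝ (Fin k))) :=
        hφi.sub (integrable_const _)
      have h2 : Integrable (fun ξ => φ ξ - φ 0 + r) (R : Measure (EuclideanSpace ℝ (Fin k))) :=
        h1.add (integrable_const _)
      rw [integral_sub h2 (G.integrable _), integral_add h1 (integrable_const _),
        integral_sub hφi (integrable_const _)]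
      simp
    rw [← e, ← Real.norm_eq_abs]
    refine (norm_integral_le_of_norm_le
      ((integrable_norm_rpow_of_mem_boundedMoment hγ hR).const_mul (r ^ (1 - γ)))
      (ae_of_all _ hpt)).trans ?_
    rw [integral_const_mul]
    gcongr
    exact integral_norm_rpow_le_of_mem_boundedMoment hγ hM hR
  have h1 := abs_le.1 (herr P hP)
  have h2 := abs_le.1 (herr Q hQ)
  exact abs_le.2 ⟨by linarith, by linarith⟩

theorem tendsto_dK_of_tendsto (hγ : 1 < γ) (hM : 0 ≤ M₀)
    {u : ℕ → ProbabilityMeasure (EuclideanSpace ℝ (Fin k))}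
    (hu : ∀ n, u n ∈ boundedMoment Ξ γ M₀) (hQ : Q ∈ boundedMoment Ξ γ M₀)
    (hlim : Tendsto u atTop (𝓝 Q)) : Tendsto (fun n => dK (u n) Q) atTop (𝓝 0) := by
  rw [Metric.tendsto_atTop]
  intro η hη
  -- The truncation level is fixed first, for the tails; `ε` is then chosen depending on `r`. The
  -- total is below `3η/4`.
  have hr : ∃ r : ℝ, 0 < r ∧ r ^ (1 - γ) * M₀ < η / 4 := by
    have h1 : Tendsto (fun r : ℝ => r ^ (1 - γ) * M₀) atTop (𝓝 (0 * M₀)) := by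
      refine Tendsto.mul_const _ ?_
      simpa using tendsto_rpow_neg_atTop (y := γ - 1) (by linarith)
    rw [zero_mul] at h1
    obtain ⟨r, h2, h3⟩ := ((eventually_gt_atTop 0).and
      (h1.eventually (gt_mem_nhds (by linarith : 0 < η / 4)))).exists
    exact ⟨r, h2, h3⟩
  obtain ⟨r, hr0, hr⟩ := hr
  obtain ⟨ε, hε, hεη⟩ : ∃ ε : ℝ, 0 < ε ∧ ε * (1 + 2 * r) ≤ η / 4 :=
    ⟨η / 4 / (1 + 2 * r), by positivity, by rw [div_mul_cancel₀ _ (by positivity)]⟩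
  have h1 : Tendsto (fun n => LevyProkhorov.ofMeasure (u n)) atTop
      (𝓝 (LevyProkhorov.ofMeasure Q)) :=
    (LevyProkhorov.continuous_ofMeasure_probabilityMeasure.tendsto Q).comp hlim
  have h2 := EMetric.tendsto_nhds.1 h1 (ENNReal.ofReal ε) (ENNReal.ofReal_pos.2 hε)
  obtain ⟨N, hN⟩ := eventually_atTop.1 h2
  refine ⟨N, fun n hn => ?_⟩
  have h3 := dK_le_of_levyProkhorovEDist_lt hγ hM (hu n) hQ hε hr0 (hN n hn)
  rw [Real.dist_eq, sub_zero, abs_of_nonneg dK_nonneg]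
  linarith

/-- Sets of measures with bounded moments of order `γ > 1` are sequentially compact for the
Kantorovich metric. -/
theorem exists_tendsto_dK_subseq (hΞ : IsClosed Ξ) (hγ : 1 < γ) (hM : 0 ≤ M₀)
    {u : ℕ → ProbabilityMeasure (EuclideanSpace ℝ (Fin k))}
    (hu : ∀ n, u n ∈ boundedMoment Ξ γ M₀) :
    ∃ Q ∈ boundedMoment Ξ γ M₀, ∃ ψ : ℕ → ℕ, StrictMono ψ ∧
      Tendsto (fun n => dK (u (ψ n)) Q) atTop (𝓝 0) := by
  -- Prokhorov's theorem gives a weak limit; the moment bound keeps it in the set and upgrades the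
  -- convergence to `dK`.
  obtain ⟨Q, -, ψ, hψ, hlim⟩ := (isCompact_closure_of_isTightMeasureSet
    (isTightMeasureSet_boundedMoment (Ξ := Ξ) (M₀ := M₀) hγ)).tendsto_subseq
      fun n => subset_closure (hu n)
  have hQ := mem_boundedMoment_of_tendsto hΞ hγ (fun n => hu (ψ n)) hlim
  exact ⟨Q, hQ, ψ, hψ, tendsto_dK_of_tendsto hγ hM (fun n => hu (ψ n)) hQ hlim⟩

/-- Sets of measures with bounded moments contain segments, which have constant speed for the
Kantorovich metric. -/
theorem exists_segment (hγ : 1 < γ) (hP : P ∈ boundedMoment Ξ γ M₀)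
    (hQ : Q ∈ boundedMoment Ξ γ M₀) :
    ∃ m : ℝ → ProbabilityMeasure (EuclideanSpace ℝ (Fin k)), m 0 = P ∧ m 1 = Q ∧
      (∀ s ∈ Icc (0 : ℝ) 1, m s ∈ boundedMoment Ξ γ M₀) ∧
      ∀ s ∈ Icc (0 : ℝ) 1, ∀ s' ∈ Icc (0 : ℝ) 1, dK (m s) (m s') ≤ |s - s'| * dK P Q := by
  let μ : ℝ → Measure (EuclideanSpace ℝ (Fin k)) := fun s =>
    ENNReal.ofReal (1 - s) • (P : Measure (EuclideanSpace ℝ (Fin k)))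
      + ENNReal.ofReal s • (Q : Measure (EuclideanSpace ℝ (Fin k)))
  have hsum : ∀ s ∈ Icc (0 : ℝ) 1, ENNReal.ofReal (1 - s) + ENNReal.ofReal s = 1 := fun s hs => by
    rw [← ENNReal.ofReal_add (by linarith [hs.2]) hs.1]; simp
  have hμ : ∀ s ∈ Icc (0 : ℝ) 1, IsProbabilityMeasure (μ s) := fun s hs =>
    ⟨by simp [μ, hsum s hs]⟩
  classical
  let m : ℝ → ProbabilityMeasure (EuclideanSpace ℝ (Fin k)) := fun s =>
    -- Outside `[0, 1]` the value `P` is an arbitrary default.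
    if hs : s ∈ Icc (0 : ℝ) 1 then ⟨μ s, hμ s hs⟩ else P
  have hm : ∀ s ∈ Icc (0 : ℝ) 1, (m s : Measure (EuclideanSpace ℝ (Fin k))) = μ s := by
    intro s hs
    have : m s = ⟨μ s, hμ s hs⟩ := dif_pos hs
    rw [this]; rfl
  have hPf := boundedMoment_subset_finiteMoment hγ hP
  have hQf := boundedMoment_subset_finiteMoment hγ hQ
  refine ⟨m, ?_, ?_, fun s hs => ⟨?_, ?_⟩, fun s hs s' hs' => dK_le fun φ hφ => ?_⟩
  · apply ProbabilityMeasure.toMeasure_injective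
    rw [hm 0 (by simp)]; simp [μ]
  · apply ProbabilityMeasure.toMeasure_injective
    rw [hm 1 (by simp)]; simp [μ]
  · have h1 : (P : Measure (EuclideanSpace ℝ (Fin k))) Ξᶜ = 0 := hP.1
    have h2 : (Q : Measure (EuclideanSpace ℝ (Fin k))) Ξᶜ = 0 := hQ.1
    change (m s : Measure (EuclideanSpace ℝ (Fin k))) Ξᶜ = 0
    rw [hm s hs]
    simp [μ, h1, h2]
  · rw [hm s hs]
    simp only [μ, lintegral_add_measure, lintegral_smul_measure, smul_eq_mul]
    calc _ ≤ ENNReal.ofReal (1 - s) * ENNReal.ofReal M₀ + ENNReal.ofReal s * ENNReal.ofReal M₀ := by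
          gcongr
          · exact hP.2
          · exact hQ.2
      _ = _ := by rw [← add_mul, hsum s hs, one_mul]
  · have key : ∀ s ∈ Icc (0 : ℝ) 1, ∫ ξ, φ ξ ∂(m s : Measure (EuclideanSpace ℝ (Fin k)))
        = (1 - s) * ∫ ξ, φ ξ ∂(P : Measure (EuclideanSpace ℝ (Fin k)))
          + s * ∫ ξ, φ ξ ∂(Q : Measure (EuclideanSpace ℝ (Fin k))) := by
      intro s hs
      rw [hm s hs]
      simp only [μ]
      rw [integral_add_measure
        ((integrable_of_lipschitzWith hPf hφ).smul_measure ENNReal.ofReal_ne_top)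
        ((integrable_of_lipschitzWith hQf hφ).smul_measure ENNReal.ofReal_ne_top),
        integral_smul_measure, integral_smul_measure, ENNReal.toReal_ofReal hs.1,
        ENNReal.toReal_ofReal (by linarith [hs.2])]
      simp
    rw [key s hs, key s' hs']
    have h := abs_integral_sub_le_dK hPf hQf hφ
    calc _ = |s - s'| * |∫ ξ, φ ξ ∂(P : Measure (EuclideanSpace ℝ (Fin k)))
        - ∫ ξ, φ ξ ∂(Q : Measure (EuclideanSpace ℝ (Fin k)))| := by
          rw [← abs_mul, ← abs_neg]; congr 1; ring
      _ ≤ _ := by gcongr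

end Moment

/-- A map on `[0, 1]` which is Lipschitz at each point, with the same constant, is Lipschitz. -/
theorem norm_sub_le_of_forall_locally {E : Type*} [NormedAddCommGroup E] {g : ℝ → E} {K : ℝ}
    (h : ∀ s ∈ Icc (0 : ℝ) 1, ∃ δ > 0, ∀ s' ∈ Icc (0 : ℝ) 1, |s' - s| < δ →
      ‖g s' - g s‖ ≤ K * |s' - s|) : ‖g 1 - g 0‖ ≤ K := by
  have hg : ContinuousOn g (Icc 0 1) := by
    intro s hs
    obtain ⟨δ, hδ, h1⟩ := h s hs
    rw [ContinuousWithinAt, tendsto_iff_norm_sub_tendsto_zero]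
    have h2 : Tendsto (fun s' => K * |s' - s|) (𝓝[Icc 0 1] s) (𝓝 0) := by
      have : Continuous fun s' => K * |s' - s| := by fun_prop
      simpa using (this.tendsto s).mono_left nhdsWithin_le_nhds
    refine squeeze_zero' (Eventually.of_forall fun _ => norm_nonneg _) ?_ h2
    filter_upwards [self_mem_nhdsWithin, mem_nhdsWithin_of_mem_nhds (Metric.ball_mem_nhds s hδ)]
      with s' hs' hs'' using h1 s' hs' (by simpa [Real.dist_eq] using hs'')
  -- Continuous induction: the set of `s` with `‖g s - g 0‖ ≤ K * s` is closed, contains `0`, and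
  -- extends to the right of each of its points in `[0, 1)`. Only comparisons with the centre `s`
  -- are used, so the radii need no lower bound.
  have hcl : IsClosed ({s | ‖g s - g 0‖ ≤ K * s} ∩ Icc 0 1) := by
    rw [inter_comm]
    exact isClosed_Icc.isClosed_le (hg.sub continuousOn_const).norm (by fun_prop)
  have := hcl.Icc_subset_of_forall_exists_gt (by simp) ?_ (right_mem_Icc.2 zero_le_one)
  · simpa using this
  rintro s ⟨hs, hs01⟩ y hy
  obtain ⟨δ, hδ, h1⟩ := h s (Ico_subset_Icc_self hs01)
  obtain ⟨s', hss', hs'⟩ := exists_between (show s < min y (min 1 (s + δ)) from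
    lt_min hy (lt_min hs01.2 (by linarith)))
  have hs1 : s' ≤ 1 := hs'.le.trans ((min_le_right _ _).trans (min_le_left _ _))
  have hs2 : s' < s + δ := hs'.trans_le ((min_le_right _ _).trans (min_le_right _ _))
  refine ⟨s', ?_, hss', hs'.le.trans (min_le_left _ _)⟩
  have h2 := h1 s' ⟨hs01.1.trans hss'.le, hs1⟩ (by rw [abs_of_pos (by linarith)]; linarith)
  rw [abs_of_pos (by linarith)] at h2
  have h3 : ‖g s' - g 0‖ ≤ ‖g s' - g s‖ + ‖g s - g 0‖ := norm_sub_le_norm_sub_add_norm_sub _ _ _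
  have hs' : ‖g s - g 0‖ ≤ K * s := hs
  change _ ≤ K * s'
  linarith

/-! ### The smoothed lateness penalty -/

section Penalty

/-- The derivative in `z` of the penalty function. -/
def penaltyDeriv (z t : ℝ) : ℝ := max (min (z + t) (2 * t)) 0 / (2 * t)

variable {t : ℝ}

theorem hasDerivAt_sq_max_zero (x : ℝ) : HasDerivAt (fun x : ℝ => max x 0 ^ 2) (2 * max x 0) x := by
  rcases lt_trichotomy x 0 with h | rfl | h
  · rw [max_eq_right h.le, mul_zero]
    refine (hasDerivAt_const x (0 : ℝ)).congr_of_eventuallyEq ?_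
    filter_upwards [gt_mem_nhds h] with y hy
    rw [max_eq_right hy.le]; simp
  · rw [hasDerivAt_iff_isLittleO_nhds_zero]
    simp only [zero_add, max_self, ne_eq, OfNat.ofNat_ne_zero, not_false_eq_true, zero_pow,
      sub_zero, mul_zero, smul_zero]
    refine Asymptotics.IsBigO.trans_isLittleO (g := fun y : ℝ => y ^ 2)
      (Asymptotics.isBigO_of_le _ fun y => ?_)
      (Asymptotics.isLittleO_pow_id one_lt_two)
    rw [norm_pow, norm_pow, Real.norm_eq_abs, Real.norm_eq_abs]
    gcongr 1
    rw [abs_of_nonneg (le_max_right _ _)]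
    exact max_le (le_abs_self _) (abs_nonneg _)
  · rw [max_eq_left h.le]
    have := (hasDerivAt_id x).pow 2
    simp only [id, Nat.cast_ofNat, Nat.add_one_sub_one, pow_one, mul_one] at this
    refine this.congr_of_eventuallyEq ?_
    filter_upwards [lt_mem_nhds h] with y hy
    rw [max_eq_left hy.le]; simp

/-- As a difference of squared positive parts, the penalty is visibly C¹, and the breakpoints `±t`
need no separate treatment in its differentiation. -/
theorem penalty_eq (ht : 0 < t) (z : ℝ) :
    penalty z t = (max (z + t) 0 ^ 2 - max (z - t) 0 ^ 2) / (4 * t) := by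
  unfold penalty
  split_ifs with h1 h2
  · rw [max_eq_left (by linarith), max_eq_left (by linarith)]; field_simp; ring
  · rw [max_eq_left (by linarith), max_eq_right (by linarith)]; ring
  · rw [max_eq_right (by linarith), max_eq_right (by linarith)]; simp

theorem hasDerivAt_penalty (ht : 0 < t) (z : ℝ) :
    HasDerivAt (fun z => penalty z t) (penaltyDeriv z t) z := by
  have h : HasDerivAt (fun z => (max (z + t) 0 ^ 2 - max (z - t) 0 ^ 2) / (4 * t))
      ((2 * max (z + t) 0 - 2 * max (z - t) 0) / (4 * t)) z :=
    (((hasDerivAt_sq_max_zero (z + t)).comp_add_const z t).sub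
      ((hasDerivAt_sq_max_zero (z - t)).comp_sub_const z t)).div_const _
  have e : penaltyDeriv z t = (2 * max (z + t) 0 - 2 * max (z - t) 0) / (4 * t) := by
    unfold penaltyDeriv
    rcases le_total t z with h1 | h1
    · rw [min_eq_right (by linarith), max_eq_left (by linarith), max_eq_left (by linarith),
        max_eq_left (by linarith)]
      field_simp; ring
    · rw [min_eq_left (by linarith), max_eq_right (by linarith : z - t ≤ 0)]
      field_simp; ring
  rw [e, show (fun z => penalty z t) = _ from funext (penalty_eq ht)]
  exact h

theorem abs_penaltyDeriv_le_one (ht : 0 < t) (z : ℝ) : |penaltyDeriv z t| ≤ 1 := by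
  unfold penaltyDeriv
  rw [abs_of_nonneg (div_nonneg (le_max_right _ _) (by linarith)), div_le_one (by linarith)]
  exact max_le (min_le_right _ _) (by linarith)

/-- Clamping is 1-Lipschitz, so only the division by `2t` remains. This is the source of the
`1/(2t)` in `CHat`. -/
theorem abs_penaltyDeriv_sub_le (ht : 0 < t) (a b : ℝ) :
    |penaltyDeriv a t - penaltyDeriv b t| ≤ 1 / (2 * t) * |a - b| := by
  have h : LipschitzWith 1 fun z : ℝ => max (min (z + t) (2 * t)) 0 :=
    ((LipschitzWith.of_dist_le_mul fun x y => by simp).min_const _).max_const _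
  have := h.dist_le_mul a b
  rw [Real.dist_eq, Real.dist_eq, NNReal.coe_one, one_mul] at this
  unfold penaltyDeriv
  rw [← sub_div, abs_div, abs_of_pos (by linarith : 0 < 2 * t), div_eq_inv_mul, one_div]
  gcongr

theorem abs_penalty_sub_le (ht : 0 < t) (a b : ℝ) : |penalty a t - penalty b t| ≤ |a - b| := by
  have := convex_univ.norm_image_sub_le_of_norm_hasDerivWithin_le (C := 1)
    (fun x _ => (hasDerivAt_penalty ht x).hasDerivWithinAt)
    (fun x _ => abs_penaltyDeriv_le_one ht x) (mem_univ b) (mem_univ a)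
  simpa using this

end Penalty

/-! ### Componentwise maps and diagonal operators on Euclidean space -/

section Diagonal

variable {ι : Type*} [Fintype ι]

theorem euclideanSpace_norm_le_of_abs_le {x y : EuclideanSpace ℝ ι} {b : ℝ} (hb : 0 ≤ b)
    (h : ∀ i, |x i| ≤ b * |y i|) : ‖x‖ ≤ b * ‖y‖ := by
  rw [EuclideanSpace.norm_eq, EuclideanSpace.norm_eq]
  refine Real.sqrt_le_iff.2 ⟨by positivity, ?_⟩
  rw [mul_pow, Real.sq_sqrt (by positivity), Finset.mul_sum]
  refine Finset.sum_le_sum fun i _ => ?_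
  rw [← mul_pow]
  exact pow_le_pow_left₀ (norm_nonneg _) (h i) 2

/-- The diagonal matrix with diagonal `w`, as an operator on Euclidean space. -/
def diagCLM (w : ι → ℝ) : EuclideanSpace ℝ ι →L[ℝ] EuclideanSpace ℝ ι :=
  LinearMap.toContinuousLinearMap
    { toFun := fun x => WithLp.toLp 2 fun i => w i * x i
      map_add' := fun x y => by ext i; simp [mul_add]
      map_smul' := fun c x => by ext i; simp; ring }

@[simp]
theorem diagCLM_apply (w : ι → ℝ) (x : EuclideanSpace ℝ ι) (i : ι) :
    diagCLM w x i = w i * x i := rfl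

theorem norm_diagCLM_le {w : ι → ℝ} {b : ℝ} (hb : 0 ≤ b) (h : ∀ i, |w i| ≤ b) :
    ‖diagCLM w‖ ≤ b :=
  ContinuousLinearMap.opNorm_le_bound _ hb fun x =>
    euclideanSpace_norm_le_of_abs_le hb fun i => by
      rw [diagCLM_apply, abs_mul]; gcongr; exact h i

theorem diagCLM_sub (w w' : ι → ℝ) : diagCLM w - diagCLM w' = diagCLM fun i => w i - w' i := by
  ext x i; simp [sub_mul]

theorem hasFDerivAt_toLp_comp {h h' : ι → ℝ → ℝ} {y : EuclideanSpace ℝ ι}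
    (hh : ∀ i, HasDerivAt (h i) (h' i (y i)) (y i)) :
    HasFDerivAt
      (fun y : EuclideanSpace ℝ ι => (WithLp.toLp 2 fun i => h i (y i) : EuclideanSpace ℝ ι))
      (diagCLM fun i => h' i (y i)) y := by
  rw [← hasFDerivWithinAt_univ, hasFDerivWithinAt_euclidean]
  intro i
  rw [hasFDerivWithinAt_univ]
  have h1 := (hh i).hasFDerivAt.comp y (EuclideanSpace.proj (𝕜 := ℝ) i).hasFDerivAt
  refine h1.congr_fderiv ?_
  ext x
  simp [mul_comm]

end Diagonal

/-! ### Derivatives and Lipschitz estimates for the disutility -/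

namespace Model

variable {Node Arc OD Route : Type*} [Fintype Arc] [Fintype OD] [Fintype Route] {k : ℕ}
  (M : Model Node Arc OD Route k) {t L : ℝ}
  {Ξ : Set (EuclideanSpace ℝ (Fin k))} {F : Set (EuclideanSpace ℝ Route)}

/-- The Jacobian of the path travel times with respect to the path flows. -/
def pathTimeDeriv (f : EuclideanSpace ℝ Route) (ξ : EuclideanSpace ℝ (Fin k)) :
    EuclideanSpace ℝ Route →L[ℝ] EuclideanSpace ℝ Route :=
  M.ΔT ∘L (fderiv ℝ (fun v => M.T v ξ) (M.Δ f)) ∘L M.Δ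

/-- The Jacobian of the penalties for lateness with respect to the path travel times. -/
def penaltyJacobian (t : ℝ) (y : EuclideanSpace ℝ Route) :
    EuclideanSpace ℝ Route →L[ℝ] EuclideanSpace ℝ Route :=
  diagCLM fun r => penaltyDeriv (y r - M.τ (M.net.od r)) t

/-- The Jacobian of the modified disutility with respect to the path flows. -/
def disutilityDeriv (t : ℝ) (f : EuclideanSpace ℝ Route) (ξ : EuclideanSpace ℝ (Fin k)) :
    EuclideanSpace ℝ Route →L[ℝ] EuclideanSpace ℝ Route :=
  M.θ₁ • M.pathTimeDeriv f ξ + M.θ₂ • (M.penaltyJacobian t (M.pathTime f ξ) ∘L M.pathTimeDeriv f ξ)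

variable {M}

theorem norm_penaltyJacobian_le (ht : 0 < t) (y : EuclideanSpace ℝ Route) :
    ‖M.penaltyJacobian t y‖ ≤ 1 :=
  norm_diagCLM_le zero_le_one fun _ => abs_penaltyDeriv_le_one ht _

theorem norm_penaltyJacobian_sub_le (ht : 0 < t) (y y' : EuclideanSpace ℝ Route) :
    ‖M.penaltyJacobian t y - M.penaltyJacobian t y'‖ ≤ 1 / (2 * t) * ‖y - y'‖ := by
  unfold penaltyJacobian
  rw [diagCLM_sub]
  refine norm_diagCLM_le (by positivity) fun r => (abs_penaltyDeriv_sub_le ht _ _).trans ?_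
  gcongr
  simpa using PiLp.norm_apply_le (y - y') r

theorem continuous_penaltyJacobian (ht : 0 < t) : Continuous (M.penaltyJacobian t) :=
  (LipschitzWith.of_dist_le_mul (K := (1 / (2 * t)).toNNReal) fun y y' => by
    rw [dist_eq_norm, dist_eq_norm, Real.coe_toNNReal _ (by positivity)]
    exact norm_penaltyJacobian_sub_le ht y y').continuous

theorem hasFDerivAt_pathTime {ξ : EuclideanSpace ℝ (Fin k)}
    (hξ : ContDiff ℝ 1 fun v => M.T v ξ) (f : EuclideanSpace ℝ Route) :
    HasFDerivAt (fun g => M.pathTime g ξ) (M.pathTimeDeriv f ξ) f :=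
  M.ΔT.hasFDerivAt.comp f
    (((hξ.differentiable one_ne_zero) (M.Δ f)).hasFDerivAt.comp f M.Δ.hasFDerivAt)

theorem continuous_pathTimeDeriv {ξ : EuclideanSpace ℝ (Fin k)}
    (hξ : ContDiff ℝ 1 fun v => M.T v ξ) :
    Continuous fun f => M.pathTimeDeriv f ξ :=
  continuous_const.clm_comp (((hξ.continuous_fderiv one_ne_zero).comp M.Δ.continuous).clm_comp
    continuous_const)

theorem hasFDerivAt_disutility {ξ : EuclideanSpace ℝ (Fin k)}
    (hξ : ContDiff ℝ 1 fun v => M.T v ξ) (ht : 0 < t) (f : EuclideanSpace ℝ Route) :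
    HasFDerivAt (fun g => M.disutility t g ξ) (M.disutilityDeriv t f ξ) f := by
  have hp : HasFDerivAt (fun y : EuclideanSpace ℝ Route =>
      (WithLp.toLp 2 fun r => penalty (y r - M.τ (M.net.od r)) t : EuclideanSpace ℝ Route))
      (M.penaltyJacobian t (M.pathTime f ξ)) (M.pathTime f ξ) :=
    hasFDerivAt_toLp_comp (h := fun r x => penalty (x - M.τ (M.net.od r)) t)
      (h' := fun r x => penaltyDeriv (x - M.τ (M.net.od r)) t)
      fun r => (hasDerivAt_penalty ht _).comp_sub_const _ _
  have hC := hasFDerivAt_pathTime hξ f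
  have := ((hC.const_smul M.θ₁).const_add (M.θ₀ • M.d)).add ((hp.comp f hC).const_smul M.θ₂)
  refine this.congr_of_eventuallyEq (Eventually.of_forall fun g => ?_)
  ext r
  simp [disutility]

theorem continuous_disutilityDeriv {ξ : EuclideanSpace ℝ (Fin k)}
    (hξ : ContDiff ℝ 1 fun v => M.T v ξ) (ht : 0 < t) :
    Continuous fun f => M.disutilityDeriv t f ξ := by
  have h1 := continuous_pathTimeDeriv hξ
  have h2 : Continuous fun f => M.pathTime f ξ :=
    continuous_iff_continuousAt.2 fun f => (hasFDerivAt_pathTime hξ f).continuousAt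
  exact (h1.const_smul M.θ₁).add
    ((((continuous_penaltyJacobian ht).comp h2).clm_comp h1).const_smul M.θ₂)

theorem norm_pathTime_sub_le (hLip : M.LipschitzTravelTime F Ξ L) {f : EuclideanSpace ℝ Route}
    (hf : f ∈ F) {ξ ξ' : EuclideanSpace ℝ (Fin k)} (hξ : ξ ∈ Ξ) (hξ' : ξ' ∈ Ξ) :
    ‖M.pathTime f ξ - M.pathTime f ξ'‖ ≤ L * ‖M.ΔT‖ * ‖ξ - ξ'‖ := by
  unfold pathTime
  rw [← map_sub]
  calc _ ≤ ‖M.ΔT‖ * ‖M.T (M.Δ f) ξ - M.T (M.Δ f) ξ'‖ := M.ΔT.le_opNorm _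
    _ ≤ ‖M.ΔT‖ * (L * ‖ξ - ξ'‖) := by
      gcongr; exact (hLip _ (mem_image_of_mem _ hf) ξ hξ ξ' hξ').1
    _ = _ := by ring

theorem norm_pathTimeDeriv_sub_le (hLip : M.LipschitzTravelTime F Ξ L)
    {f : EuclideanSpace ℝ Route} (hf : f ∈ F) {ξ ξ' : EuclideanSpace ℝ (Fin k)} (hξ : ξ ∈ Ξ)
    (hξ' : ξ' ∈ Ξ) :
    ‖M.pathTimeDeriv f ξ - M.pathTimeDeriv f ξ'‖ ≤ L * ‖M.ΔT‖ * ‖M.Δ‖ * ‖ξ - ξ'‖ := by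
  unfold pathTimeDeriv
  rw [← ContinuousLinearMap.comp_sub, ← ContinuousLinearMap.sub_comp]
  calc _ ≤ ‖M.ΔT‖ * (‖fderiv ℝ (fun v => M.T v ξ) (M.Δ f) - fderiv ℝ (fun v => M.T v ξ') (M.Δ f)‖
        * ‖M.Δ‖) := (ContinuousLinearMap.opNorm_comp_le _ _).trans (by
          gcongr; exact ContinuousLinearMap.opNorm_comp_le _ _)
    _ ≤ ‖M.ΔT‖ * (L * ‖ξ - ξ'‖ * ‖M.Δ‖) := by
      gcongr; exact (hLip _ (mem_image_of_mem _ hf) ξ hξ ξ' hξ').2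
    _ = _ := by ring

theorem norm_disutility_sub_le (hθ₁ : 0 ≤ M.θ₁) (hθ₂ : 0 ≤ M.θ₂) (ht : 0 < t)
    (hLip : M.LipschitzTravelTime F Ξ L) {f : EuclideanSpace ℝ Route}
    (hf : f ∈ F) {ξ ξ' : EuclideanSpace ℝ (Fin k)} (hξ : ξ ∈ Ξ) (hξ' : ξ' ∈ Ξ) :
    ‖M.disutility t f ξ - M.disutility t f ξ'‖ ≤ L * ‖M.ΔT‖ * (M.θ₁ + M.θ₂) * ‖ξ - ξ'‖ := by
  calc _ ≤ (M.θ₁ + M.θ₂) * ‖M.pathTime f ξ - M.pathTime f ξ'‖ := by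
        refine euclideanSpace_norm_le_of_abs_le (by positivity) fun r => ?_
        have h := abs_penalty_sub_le ht (M.pathTime f ξ r - M.τ (M.net.od r))
          (M.pathTime f ξ' r - M.τ (M.net.od r))
        rw [sub_sub_sub_cancel_right] at h
        simp only [disutility, PiLp.sub_apply]
        calc _ = |M.θ₁ * (M.pathTime f ξ r - M.pathTime f ξ' r)
              + M.θ₂ * (penalty (M.pathTime f ξ r - M.τ (M.net.od r)) t
                - penalty (M.pathTime f ξ' r - M.τ (M.net.od r)) t)| := by congr 1; ring
          _ ≤ _ := abs_add_le _ _
          _ ≤ M.θ₁ * |M.pathTime f ξ r - M.pathTime f ξ' r|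
              + M.θ₂ * |M.pathTime f ξ r - M.pathTime f ξ' r| := by
            rw [abs_mul, abs_mul, abs_of_nonneg hθ₁, abs_of_nonneg hθ₂]; gcongr
          _ = _ := by ring
    _ ≤ (M.θ₁ + M.θ₂) * (L * ‖M.ΔT‖ * ‖ξ - ξ'‖) := by
        gcongr; exact norm_pathTime_sub_le hLip hf hξ hξ'
    _ = _ := by ring

theorem norm_disutilityDeriv_le (hθ₁ : 0 ≤ M.θ₁) (hθ₂ : 0 ≤ M.θ₂) (ht : 0 < t)
    (f : EuclideanSpace ℝ Route) (ξ : EuclideanSpace ℝ (Fin k)) :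
    ‖M.disutilityDeriv t f ξ‖ ≤ (M.θ₁ + M.θ₂) * ‖M.pathTimeDeriv f ξ‖ := by
  unfold disutilityDeriv
  refine (norm_add_le _ _).trans ?_
  rw [norm_smul, norm_smul, Real.norm_of_nonneg hθ₁, Real.norm_of_nonneg hθ₂, add_mul]
  gcongr
  calc _ ≤ ‖M.penaltyJacobian t (M.pathTime f ξ)‖ * ‖M.pathTimeDeriv f ξ‖ :=
        ContinuousLinearMap.opNorm_comp_le _ _
    _ ≤ 1 * _ := by gcongr; exact norm_penaltyJacobian_le ht _
    _ = _ := one_mul _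

theorem norm_disutilityDeriv_sub_le (hθ₁ : 0 ≤ M.θ₁) (hθ₂ : 0 ≤ M.θ₂) (ht : 0 < t)
    (hLip : M.LipschitzTravelTime F Ξ L) {c : ℝ} {f : EuclideanSpace ℝ Route}
    (hf : f ∈ F) {ξ ξ' : EuclideanSpace ℝ (Fin k)} (hξ : ξ ∈ Ξ) (hξ' : ξ' ∈ Ξ)
    (hc : ‖M.pathTimeDeriv f ξ'‖ ≤ c) :
    ‖M.disutilityDeriv t f ξ - M.disutilityDeriv t f ξ'‖
      ≤ L * ‖M.ΔT‖ * (M.θ₁ * ‖M.Δ‖ + M.θ₂ * ‖M.Δ‖ + M.θ₂ * (c / (2 * t))) * ‖ξ - ξ'‖ := by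
  set A := M.pathTimeDeriv f ξ
  set A' := M.pathTimeDeriv f ξ'
  set J := M.penaltyJacobian t (M.pathTime f ξ)
  set J' := M.penaltyJacobian t (M.pathTime f ξ')
  -- The product rule for increments, `JA - J'A' = J(A - A') + (J - J')A'`: the first term uses `‖J‖
  -- ≤ 1`, and the second multiplies the bound `c` on `A'` by the modulus `1/(2t)` of `J`.
  have e : M.disutilityDeriv t f ξ - M.disutilityDeriv t f ξ'
      = M.θ₁ • (A - A') + M.θ₂ • (J ∘L (A - A') + (J - J') ∘L A') := by
    change M.θ₁ • A + M.θ₂ • (J ∘L A) - (M.θ₁ • A' + M.θ₂ • (J' ∘L A')) = _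
    rw [ContinuousLinearMap.comp_sub, ContinuousLinearMap.sub_comp]
    module
  have hA : ‖A - A'‖ ≤ L * ‖M.ΔT‖ * ‖M.Δ‖ * ‖ξ - ξ'‖ := norm_pathTimeDeriv_sub_le hLip hf hξ hξ'
  have hJ : ‖J - J'‖ ≤ 1 / (2 * t) * (L * ‖M.ΔT‖ * ‖ξ - ξ'‖) :=
    (norm_penaltyJacobian_sub_le ht _ _).trans (by
      gcongr; exact norm_pathTime_sub_le hLip hf hξ hξ')
  have h1 : ‖J ∘L (A - A')‖ ≤ 1 * (L * ‖M.ΔT‖ * ‖M.Δ‖ * ‖ξ - ξ'‖) :=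
    (ContinuousLinearMap.opNorm_comp_le _ _).trans
      (mul_le_mul (norm_penaltyJacobian_le ht _) hA (norm_nonneg _) zero_le_one)
  have h2 : ‖(J - J') ∘L A'‖ ≤ 1 / (2 * t) * (L * ‖M.ΔT‖ * ‖ξ - ξ'‖) * c :=
    (ContinuousLinearMap.opNorm_comp_le _ _).trans
      (mul_le_mul hJ hc (norm_nonneg _) ((norm_nonneg _).trans hJ))
  rw [e]
  calc _ ≤ ‖M.θ₁ • (A - A')‖ + ‖M.θ₂ • (J ∘L (A - A') + (J - J') ∘L A')‖ := norm_add_le _ _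
    _ ≤ M.θ₁ * (L * ‖M.ΔT‖ * ‖M.Δ‖ * ‖ξ - ξ'‖)
        + M.θ₂ * (1 * (L * ‖M.ΔT‖ * ‖M.Δ‖ * ‖ξ - ξ'‖)
          + 1 / (2 * t) * (L * ‖M.ΔT‖ * ‖ξ - ξ'‖) * c) := by
      rw [norm_smul, norm_smul, Real.norm_of_nonneg hθ₁, Real.norm_of_nonneg hθ₂]
      gcongr
      exact (norm_add_le _ _).trans (add_le_add h1 h2)
    _ = _ := by ring

/-- At one fixed `ξ₀` the Jacobian is continuous in `f` and bounded on the compact `F`; the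
Lipschitz estimate in `ξ` then costs at most a multiple of the diameter of `Ξ`. -/
theorem bddAbove_jacobianNorms (hF : IsCompact F) (hΞ : IsCompact Ξ)
    (hT : ∀ ξ ∈ Ξ, ContDiff ℝ 1 (fun v => M.T v ξ)) (hL : 0 ≤ L)
    (hLip : M.LipschitzTravelTime F Ξ L) : BddAbove (M.jacobianNorms F Ξ) := by
  rcases Ξ.eq_empty_or_nonempty with rfl | ⟨ξ₀, hξ₀⟩
  · simp [jacobianNorms]
  obtain ⟨B, hB⟩ := hF.exists_bound_of_continuousOn
    (continuous_pathTimeDeriv (hT ξ₀ hξ₀)).continuousOn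
  refine ⟨B + L * ‖M.ΔT‖ * ‖M.Δ‖ * Metric.diam Ξ, ?_⟩
  rintro _ ⟨f, hf, ξ, hξ, rfl⟩
  rw [(hasFDerivAt_pathTime (hT ξ hξ) f).fderiv]
  have h1 := norm_pathTimeDeriv_sub_le hLip hf hξ hξ₀
  have h2 : ‖ξ - ξ₀‖ ≤ Metric.diam Ξ := by
    rw [← dist_eq_norm]; exact Metric.dist_le_diam_of_mem hΞ.isBounded hξ hξ₀
  calc _ = ‖M.pathTimeDeriv f ξ₀ + (M.pathTimeDeriv f ξ - M.pathTimeDeriv f ξ₀)‖ := by congr 1; abel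
    _ ≤ _ := norm_add_le _ _
    _ ≤ _ := add_le_add (hB f hf) (h1.trans (by gcongr))

end Model

/-! ### Stability of generalized equations with expectations -/

/-- A family of maps `u · ξ` which are continuously differentiable with derivatives `u' · ξ`, such
that `u'` is bounded and `u`, `u'` are Lipschitz continuous in `ξ ∈ Ξ` with modulus `S` over
`F`. -/
structure IsLipschitzFamily {E : Type*} [NormedAddCommGroup E] [InnerProductSpace ℝ E] {k : ℕ}
    (u : E → EuclideanSpace ℝ (Fin k) → E) (u' : E → EuclideanSpace ℝ (Fin k) → E →L[ℝ] E)
    (F : Set E) (Ξ : Set (EuclideanSpace ℝ (Fin k))) (S : ℝ≥0) : Prop where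
  hasFDerivAt : ∀ ξ ∈ Ξ, ∀ f, HasFDerivAt (fun g => u g ξ) (u' f ξ) f
  continuous_deriv : ∀ ξ ∈ Ξ, Continuous fun f => u' f ξ
  bounded : ∃ B : ℝ, ∀ f ∈ F, ∀ ξ ∈ Ξ, ‖u' f ξ‖ ≤ B
  lipschitz : ∀ f ∈ F, LipschitzOnWith S (u f) Ξ
  lipschitz_deriv : ∀ f ∈ F, LipschitzOnWith S (u' f) Ξ

/-- The expectation of `u f ξ` under `Q`, as a function of `f`. -/
def expect {E : Type*} [NormedAddCommGroup E] [NormedSpace ℝ E] {k : ℕ}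
    (u : E → EuclideanSpace ℝ (Fin k) → E)
    (Q : ProbabilityMeasure (EuclideanSpace ℝ (Fin k))) (f : E) : E :=
  ∫ ξ, u f ξ ∂(Q : Measure (EuclideanSpace ℝ (Fin k)))

namespace IsLipschitzFamily

variable {E : Type*} [NormedAddCommGroup E] [InnerProductSpace ℝ E] {k : ℕ}
  {u : E → EuclideanSpace ℝ (Fin k) → E} {u' : E → EuclideanSpace ℝ (Fin k) → E →L[ℝ] E}
  {F : Set E} {Ξ : Set (EuclideanSpace ℝ (Fin k))} {S : ℝ≥0}
  {P Q : ProbabilityMeasure (EuclideanSpace ℝ (Fin k))} {N : E → Set E}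

/-- Differentiation under the integral, dominated by the uniform bound on `u'`, holds near `f`;
dominated convergence makes the derivative continuous at `f`, hence strict, as linearization in
Robinson's theorem requires. -/
theorem hasStrictFDerivAt_expect (h : IsLipschitzFamily u u' F Ξ S) (hΞ : IsClosed Ξ)
    (hQ : Q ∈ finiteMoment Ξ) {f : E} (hf : F ∈ 𝓝 f) :
    HasStrictFDerivAt (expect u Q) (∫ ξ, u' f ξ ∂(Q : Measure (EuclideanSpace ℝ (Fin k)))) f := by
  obtain ⟨B, hB⟩ := h.bounded
  have hae := ae_mem_of_mem_probOn hQ.1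
  have hmeas' : ∀ g ∈ F, AEStronglyMeasurable (u' g) (Q : Measure (EuclideanSpace ℝ (Fin k))) :=
    fun g hg => aestronglyMeasurable_of_continuousOn hΞ hQ.1 (h.lipschitz_deriv g hg).continuousOn
  refine hasStrictFDerivAt_of_hasFDerivAt_of_continuousAt
    (f' := fun g => ∫ ξ, u' g ξ ∂(Q : Measure (EuclideanSpace ℝ (Fin k)))) ?_ ?_
  · filter_upwards [eventually_mem_nhds_iff.2 hf] with g hg
    refine hasFDerivAt_integral_of_dominated_of_fderiv_le hg ?_
      (integrable_of_lipschitzOnWith hΞ hQ (h.lipschitz g (mem_of_mem_nhds hg)))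
      (hmeas' g (mem_of_mem_nhds hg)) ?_ (integrable_const B) ?_
    · filter_upwards [hg] with x hx
      exact aestronglyMeasurable_of_continuousOn hΞ hQ.1 (h.lipschitz x hx).continuousOn
    · filter_upwards [hae] with ξ hξ x hx using hB x hx ξ hξ
    · filter_upwards [hae] with ξ hξ x _ using h.hasFDerivAt ξ hξ x
  · refine continuousAt_of_dominated (bound := fun _ => B) ?_ ?_ (integrable_const B) ?_
    · filter_upwards [hf] with x hx using hmeas' x hx
    · filter_upwards [hf] with x hx
      filter_upwards [hae] with ξ hξ using hB x hx ξ hξ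
    · filter_upwards [hae] with ξ hξ using (h.continuous_deriv ξ hξ).continuousAt

theorem norm_expect_sub_le [CompleteSpace E] (h : IsLipschitzFamily u u' F Ξ S)
    (hΞ : IsClosed Ξ) (hP : P ∈ finiteMoment Ξ) (hQ : Q ∈ finiteMoment Ξ) {f : E} (hf : f ∈ F) :
    ‖expect u P f - expect u Q f‖ ≤ S * dK P Q :=
  norm_integral_sub_le_mul_dK hΞ hP hQ (h.lipschitz f hf)

/-- The mean value inequality on the convex `F`, applied to `u · ξ - u · ξ'`, shows that `u f ξ - u
g ξ` is Lipschitz in `ξ` with modulus `S * ‖f - g‖`; duality then gives a Lipschitz bound in `f` on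
the perturbation. -/
theorem norm_expect_sub_sub_le [CompleteSpace E] (h : IsLipschitzFamily u u' F Ξ S)
    (hΞ : IsClosed Ξ) (hF : Convex ℝ F) (hP : P ∈ finiteMoment Ξ) (hQ : Q ∈ finiteMoment Ξ)
    {f g : E} (hf : f ∈ F) (hg : g ∈ F) :
    ‖(expect u P f - expect u Q f) - (expect u P g - expect u Q g)‖
      ≤ S * dK P Q * ‖f - g‖ := by
  have hlip : LipschitzOnWith (S * ‖f - g‖₊) (fun ξ => u f ξ - u g ξ) Ξ := by
    refine LipschitzOnWith.of_dist_le_mul fun ξ hξ ξ' hξ' => ?_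
    have := hF.norm_image_sub_le_of_norm_hasFDerivWithin_le (C := S * dist ξ ξ')
      (f := fun x => u x ξ - u x ξ') (f' := fun x => u' x ξ - u' x ξ')
      (fun x _ => ((h.hasFDerivAt ξ hξ x).sub (h.hasFDerivAt ξ' hξ' x)).hasFDerivWithinAt)
      (fun x hx => by
        rw [← dist_eq_norm]; exact (h.lipschitz_deriv x hx).dist_le_mul ξ hξ ξ' hξ') hg hf
    rw [dist_eq_norm]
    calc _ = ‖u f ξ - u f ξ' - (u g ξ - u g ξ')‖ := by congr 1; abel
      _ ≤ _ := this
      _ = _ := by push_cast; ring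
  have hi : ∀ R ∈ finiteMoment Ξ, ∫ ξ, (u f ξ - u g ξ) ∂(R : Measure (EuclideanSpace ℝ (Fin k)))
      = expect u R f - expect u R g := fun R hR =>
    integral_sub (integrable_of_lipschitzOnWith hΞ hR (h.lipschitz f hf))
      (integrable_of_lipschitzOnWith hΞ hR (h.lipschitz g hg))
  have := norm_integral_sub_le_mul_dK hΞ hP hQ hlip
  rw [hi P hP, hi Q hQ] at this
  calc _ = ‖expect u P f - expect u P g - (expect u Q f - expect u Q g)‖ := by congr 1; abel
    _ ≤ _ := this
    _ = _ := by push_cast; ring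

/-- Near a strongly regular solution, the generalized equation with an expectation has exactly one
solution, which is Lipschitz continuous in the probability measure. -/
theorem exists_local_stability [CompleteSpace E] (h : IsLipschitzFamily u u' F Ξ S)
    (hΞ : IsClosed Ξ) (hF : Convex ℝ F) (hP : P ∈ finiteMoment Ξ) {z₀ : E}
    (hz₀ : StronglyRegular (expect u P) N z₀) (hF₀ : F ∈ 𝓝 z₀) :
    ∃ V ∈ 𝓝 z₀, ∃ δ > 0, ∃ κ > 0,
      (∀ Q ∈ finiteMoment Ξ, dK Q P ≤ δ → ∃ z, geSolutions (expect u Q) N ∩ V = {z}) ∧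
      ∀ Q₁ ∈ finiteMoment Ξ, ∀ Q₂ ∈ finiteMoment Ξ, dK Q₁ P ≤ δ → dK Q₂ P ≤ δ →
        ∀ z₁ ∈ geSolutions (expect u Q₁) N ∩ V, ∀ z₂ ∈ geSolutions (expect u Q₂) N ∩ V,
          ‖z₁ - z₂‖ ≤ κ * S * dK Q₁ Q₂ := by
  have hd := h.hasStrictFDerivAt_expect hΞ hP hF₀
  rw [← hd.hasFDerivAt.fderiv] at hd
  obtain ⟨V, hV, hVF, ε, hε, κ, hκ, hex, hst⟩ := hz₀.exists_stable hd hF₀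
  -- The radius is `ε / (S + 1)` rather than `ε / S` because `S` may vanish.
  have hS : ∀ Q : ProbabilityMeasure (EuclideanSpace ℝ (Fin k)), dK Q P ≤ ε / (S + 1) →
      S * dK Q P ≤ ε := fun Q hQ => by
    calc S * dK Q P ≤ (S + 1) * (ε / (S + 1)) := by
          refine mul_le_mul (by linarith) hQ dK_nonneg (by positivity)
      _ = ε := by field_simp
  have h1 : ∀ Q ∈ finiteMoment Ξ, dK Q P ≤ ε / (S + 1) → ∀ x ∈ V, ∀ y ∈ V,
      ‖(expect u Q x - expect u P x) - (expect u Q y - expect u P y)‖ ≤ ε * ‖x - y‖ :=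
    fun Q hQ hQP x hx y hy =>
      (h.norm_expect_sub_sub_le hΞ hF hQ hP (hVF hx) (hVF hy)).trans (by
        gcongr; exact hS Q hQP)
  have h2 : ∀ Q ∈ finiteMoment Ξ, dK Q P ≤ ε / (S + 1) →
      ‖expect u Q z₀ - expect u P z₀‖ ≤ ε := fun Q hQ hQP =>
    (h.norm_expect_sub_le hΞ hQ hP (mem_of_mem_nhds hF₀)).trans (hS Q hQP)
  refine ⟨V, hV, ε / (S + 1), by positivity, κ, hκ,
    fun Q hQ hQP => hex _ (h1 Q hQ hQP) (h2 Q hQ hQP),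
    fun Q₁ hQ₁ Q₂ hQ₂ hP₁ hP₂ z₁ hz₁ z₂ hz₂ => ?_⟩
  calc _ ≤ κ * ‖expect u Q₁ z₂ - expect u Q₂ z₂‖ :=
        hst _ _ (h1 Q₁ hQ₁ hP₁) (h2 Q₁ hQ₁ hP₁) (h1 Q₂ hQ₂ hP₂) (h2 Q₂ hQ₂ hP₂) z₁ hz₁ z₂ hz₂
    _ ≤ κ * (S * dK Q₁ Q₂) := by
        gcongr; exact h.norm_expect_sub_le hΞ hQ₁ hQ₂ (hVF hz₂.2)
    _ = _ := by ring

/-- A continuous selection of strongly regular solutions over a set of measures with bounded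
moments of order `γ > 1` is Lipschitz continuous. -/
theorem exists_global_stability [CompleteSpace E] (h : IsLipschitzFamily u u' F Ξ S)
    (hΞ : IsClosed Ξ) (hF : Convex ℝ F) {γ M₀ : ℝ} (hγ : 1 < γ) (hM : 0 ≤ M₀)
    {f : ProbabilityMeasure (EuclideanSpace ℝ (Fin k)) → E}
    (hf : ∀ Q ∈ boundedMoment Ξ γ M₀, StronglyRegular (expect u Q) N (f Q) ∧ F ∈ 𝓝 (f Q))
    (hcont : ∀ Q ∈ boundedMoment Ξ γ M₀, ∀ ε > 0, ∃ δ > 0,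
      ∀ Q' ∈ boundedMoment Ξ γ M₀, dK Q' Q < δ → ‖f Q' - f Q‖ < ε) :
    ∃ C : ℝ, 0 < C ∧ ∀ Q₁ ∈ boundedMoment Ξ γ M₀, ∀ Q₂ ∈ boundedMoment Ξ γ M₀,
      ‖f Q₁ - f Q₂‖ ≤ C * S * dK Q₁ Q₂ := by
  have hsub : boundedMoment Ξ γ M₀ ⊆ finiteMoment Ξ := boundedMoment_subset_finiteMoment hγ
  have hloc : ∀ Q ∈ boundedMoment Ξ γ M₀, ∃ κ > 0, ∃ δ > 0,
      ∀ Q₁ ∈ boundedMoment Ξ γ M₀, ∀ Q₂ ∈ boundedMoment Ξ γ M₀, dK Q₁ Q < δ → dK Q₂ Q < δ →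
        ‖f Q₁ - f Q₂‖ ≤ κ * S * dK Q₁ Q₂ := by
    intro Q hQ
    obtain ⟨V, hV, δ, hδ, κ, hκ, -, hst⟩ :=
      h.exists_local_stability hΞ hF (hsub hQ) (hf Q hQ).1 (hf Q hQ).2
    obtain ⟨ε, hε, hεV⟩ := Metric.mem_nhds_iff.1 hV
    obtain ⟨δ', hδ', hδ'V⟩ := hcont Q hQ ε hε
    -- Continuity of the selection places `f Q'` in the neighbourhood `V` where the local estimate
    -- applies.
    have hmem : ∀ Q' ∈ boundedMoment Ξ γ M₀, dK Q' Q < δ' →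
        f Q' ∈ geSolutions (expect u Q') N ∩ V := fun Q' hQ' hd =>
      ⟨(hf Q' hQ').1.1, hεV (by rw [Metric.mem_ball, dist_eq_norm]; exact hδ'V Q' hQ' hd)⟩
    exact ⟨κ, hκ, min δ δ', lt_min hδ hδ', fun Q₁ hQ₁ Q₂ hQ₂ h₁ h₂ =>
      hst Q₁ (hsub hQ₁) Q₂ (hsub hQ₂) (h₁.le.trans (min_le_left _ _))
        (h₂.le.trans (min_le_left _ _)) _ (hmem Q₁ hQ₁ (h₁.trans_le (min_le_right _ _))) _
        (hmem Q₂ hQ₂ (h₂.trans_le (min_le_right _ _)))⟩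
  -- Only `κ` is uniform; `δ` still depends on `Q`. If no `κ` worked, measures violating the
  -- estimate with constants `n + 1` would accumulate at some `Q`, where the local constant
  -- eventually contradicts them.
  obtain ⟨κ, hκ, hunif⟩ : ∃ κ > 0, ∀ Q ∈ boundedMoment Ξ γ M₀, ∃ δ > 0,
      ∀ Q' ∈ boundedMoment Ξ γ M₀, dK Q' Q < δ → ‖f Q' - f Q‖ ≤ κ * S * dK Q' Q := by
    by_contra! hcon
    choose v hv hv' using fun n : ℕ => hcon (n + 1) (by positivity)
    obtain ⟨Q, hQ, ψ, hψ, hlim⟩ := exists_tendsto_dK_subseq hΞ hγ hM hv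
    obtain ⟨κ, -, δ, hδ, hκ⟩ := hloc Q hQ
    obtain ⟨n, hn, hnκ⟩ := ((hlim.eventually (gt_mem_nhds (half_pos hδ))).and
      ((tendsto_natCast_atTop_atTop.comp hψ.tendsto_atTop).eventually_ge_atTop κ)).exists
    obtain ⟨Q', hQ', hd, hlt⟩ := hv' (ψ n) (δ / 2) (half_pos hδ)
    have htri := dK_triangle (hsub hQ') (hsub (hv (ψ n))) (hsub hQ)
    have h1 := hκ Q' hQ' (v (ψ n)) (hv _) (by linarith) (by linarith)
    have h2 : κ * S * dK Q' (v (ψ n)) ≤ ((ψ n : ℝ) + 1) * S * dK Q' (v (ψ n)) := by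
      have : κ ≤ (ψ n : ℝ) + 1 := by simp only [Function.comp_apply] at hnκ; linarith
      gcongr
      exact dK_nonneg
    linarith
  refine ⟨κ, hκ, fun Q₁ hQ₁ Q₂ hQ₂ => ?_⟩
  obtain ⟨m, hm0, hm1, hm, hdist⟩ := exists_segment hγ hQ₁ hQ₂
  have hd0 : 0 ≤ dK Q₁ Q₂ := dK_nonneg
  have key := norm_sub_le_of_forall_locally (g := fun s => f (m s)) (K := κ * S * dK Q₁ Q₂) ?_
  · simp only [hm0, hm1] at key
    rwa [norm_sub_rev]
  intro s hs
  obtain ⟨δ, hδ, h1⟩ := hunif (m s) (hm s hs)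
  -- Along the segment, parameter distances are scaled by at most `dK Q₁ Q₂`, which may be zero.
  refine ⟨δ / (dK Q₁ Q₂ + 1), by positivity, fun s' hs' hss' => ?_⟩
  have h2 := hdist s' hs' s hs
  have h3 : dK (m s') (m s) < δ := by
    rw [lt_div_iff₀ (by positivity)] at hss'
    have : 0 ≤ |s' - s| := abs_nonneg _
    refine h2.trans_lt (lt_of_le_of_lt ?_ hss')
    gcongr
    linarith
  calc _ ≤ κ * S * dK (m s') (m s) := h1 _ (hm s' hs') h3
    _ ≤ κ * S * (|s' - s| * dK Q₁ Q₂) := by gcongr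
    _ = _ := by ring

end IsLipschitzFamily

/-! ### Application to the equilibrium model -/

/-- `stabilityConst` is the sum of the modulus of the disutility, with factor `θ₁ + θ₂`, and that of
its Jacobian, the remaining terms. It therefore dominates both and can serve as the single modulus
`S`. -/
theorem Model.isLipschitzFamily_disutility {Node Arc OD Route : Type*} [Fintype Arc] [Fintype OD]
    [Fintype Route] {k : ℕ} {M : Model Node Arc OD Route k} (hθ₁ : 0 ≤ M.θ₁) (hθ₂ : 0 ≤ M.θ₂)
    {t : ℝ} (ht : 0 < t) {Ξ : Set (EuclideanSpace ℝ (Fin k))} {F : Set (EuclideanSpace ℝ Route)}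
    (hbdd : BddAbove (M.jacobianNorms F Ξ)) (hT : ∀ ξ ∈ Ξ, ContDiff ℝ 1 (fun v => M.T v ξ))
    {L : ℝ} (hL : 0 ≤ L) (hLip : M.LipschitzTravelTime F Ξ L) :
    0 ≤ M.stabilityConst F Ξ L t ∧ IsLipschitzFamily (M.disutility t) (M.disutilityDeriv t) F Ξ
      (M.stabilityConst F Ξ L t).toNNReal := by
  have hC : ∀ f ∈ F, ∀ ξ ∈ Ξ, ‖M.pathTimeDeriv f ξ‖ ≤ sSup (M.jacobianNorms F Ξ) :=
    fun f hf ξ hξ => le_csSup hbdd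
      ⟨f, hf, ξ, hξ, by rw [(hasFDerivAt_pathTime (hT ξ hξ) f).fderiv]⟩
  have hC0 : 0 ≤ sSup (M.jacobianNorms F Ξ) := Real.sSup_nonneg (by
    rintro _ ⟨f, _, ξ, _, rfl⟩; exact norm_nonneg _)
  have hCH : 0 ≤ M.CHat F Ξ t := div_nonneg hC0 (by positivity)
  have hS : 0 ≤ M.stabilityConst F Ξ L t := by unfold stabilityConst; positivity
  refine ⟨hS, fun ξ hξ f => hasFDerivAt_disutility (hT ξ hξ) ht f,
    fun ξ hξ => continuous_disutilityDeriv (hT ξ hξ) ht, ?_, ?_, ?_⟩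
  · refine ⟨(M.θ₁ + M.θ₂) * sSup (M.jacobianNorms F Ξ), fun f hf ξ hξ =>
      (norm_disutilityDeriv_le hθ₁ hθ₂ ht f ξ).trans ?_⟩
    gcongr
    exact hC f hf ξ hξ
  · refine fun f hf => LipschitzOnWith.of_dist_le_mul fun ξ hξ ξ' hξ' => ?_
    rw [dist_eq_norm, dist_eq_norm, Real.coe_toNNReal _ hS]
    refine (norm_disutility_sub_le hθ₁ hθ₂ ht hLip hf hξ hξ').trans ?_
    unfold stabilityConst
    gcongr L * ‖M.ΔT‖ * ?_ * _
    have h1 : 0 ≤ M.θ₁ * ‖M.Δ‖ := by positivity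
    have h2 : 0 ≤ M.θ₂ * ‖M.Δ‖ := by positivity
    have h3 : 0 ≤ M.θ₂ * M.CHat F Ξ t := by positivity
    linarith
  · refine fun f hf => LipschitzOnWith.of_dist_le_mul fun ξ hξ ξ' hξ' => ?_
    rw [dist_eq_norm, dist_eq_norm, Real.coe_toNNReal _ hS]
    refine (norm_disutilityDeriv_sub_le hθ₁ hθ₂ ht hLip hf hξ hξ' (hC f hf ξ' hξ')).trans ?_
    unfold stabilityConst CHat
    gcongr L * ‖M.ΔT‖ * ?_ * _
    linarith

end MLAPUE

end

theorem theorem3p2 {Node Arc OD Route : Type*} [Fintype Arc] [Fintype OD] [Fintype Route]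
    {k : ℕ} (M : MLAPUE.Model Node Arc OD Route k)
    (hθ₁ : 0 ≤ M.θ₁) (hθ₂ : 0 ≤ M.θ₂)
    (t : ℝ) (ht : 0 < t)
    (Ξ : Set (EuclideanSpace ℝ (Fin k))) (F : Set (EuclideanSpace ℝ Route))
    (hF : IsCompact F) (hFconv : Convex ℝ F)
    (hΞ : IsCompact Ξ ∨ (IsClosed Ξ ∧ BddAbove (M.jacobianNorms F Ξ)))
    (hT : ∀ ξ ∈ Ξ, ContDiff ℝ 1 (fun v => M.T v ξ))
    (L : ℝ) (hL : 0 < L) (hLip : M.LipschitzTravelTime F Ξ L) :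
    -- part (i)
    (∀ P ∈ MLAPUE.finiteMoment Ξ, ∀ fP : EuclideanSpace ℝ Route,
      M.IsRegularEquilibrium t P fP → F ∈ 𝓝 fP →
      ∃ (f : ProbabilityMeasure (EuclideanSpace ℝ (Fin k)) → EuclideanSpace ℝ Route)
        (V : Set (EuclideanSpace ℝ Route)) (δ κ : ℝ),
        V ∈ 𝓝 fP ∧ 0 < δ ∧ 0 < κ ∧ f P = fP ∧
        (∀ Q ∈ MLAPUE.finiteMoment Ξ, MLAPUE.dK Q P ≤ δ → M.equilibria t Q ∩ V = {f Q}) ∧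
        ∀ Q₁ ∈ MLAPUE.finiteMoment Ξ, ∀ Q₂ ∈ MLAPUE.finiteMoment Ξ,
          MLAPUE.dK Q₁ P ≤ δ → MLAPUE.dK Q₂ P ≤ δ →
          ‖f Q₁ - f Q₂‖ ≤ κ * M.stabilityConst F Ξ L t * MLAPUE.dK Q₁ Q₂) ∧
    -- part (ii)
    (∀ γ M₀ : ℝ, 1 < γ → 0 < M₀ →
      ∀ f : ProbabilityMeasure (EuclideanSpace ℝ (Fin k)) → EuclideanSpace ℝ Route,
      (∀ Q ∈ MLAPUE.boundedMoment Ξ γ M₀, M.IsRegularEquilibrium t Q (f Q) ∧ F ∈ 𝓝 (f Q)) →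
      (∀ Q ∈ MLAPUE.boundedMoment Ξ γ M₀, ∀ ε > 0, ∃ δ > 0,
        ∀ Q' ∈ MLAPUE.boundedMoment Ξ γ M₀, MLAPUE.dK Q' Q < δ → ‖f Q' - f Q‖ < ε) →
      ∃ C : ℝ, 0 < C ∧
        ∀ Q₁ ∈ MLAPUE.boundedMoment Ξ γ M₀, ∀ Q₂ ∈ MLAPUE.boundedMoment Ξ γ M₀,
          ‖f Q₁ - f Q₂‖ ≤ C * M.stabilityConst F Ξ L t * MLAPUE.dK Q₁ Q₂) := by
  have hclosed : IsClosed Ξ := hΞ.elim IsCompact.isClosed And.left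
  have hbdd : BddAbove (M.jacobianNorms F Ξ) :=
    hΞ.elim (fun h => MLAPUE.Model.bddAbove_jacobianNorms hF h hT hL.le hLip) And.right
  obtain ⟨hS, hfam⟩ := MLAPUE.Model.isLipschitzFamily_disutility hθ₁ hθ₂ ht hbdd hT hL.le hLip
  have hcoe := Real.coe_toNNReal _ hS
  refine ⟨fun P hP fP hreg hFP => ?_, fun γ M₀ hγ hM f hf hcont => ?_⟩
  · obtain ⟨V, hV, δ, hδ, κ, hκ, hex, hst⟩ :=
      hfam.exists_local_stability hclosed hFconv hP hreg hFP
    choose! f hf using hex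
    have hmem : ∀ Q ∈ MLAPUE.finiteMoment Ξ, MLAPUE.dK Q P ≤ δ → f Q ∈ M.equilibria t Q ∩ V :=
      fun Q hQ hQP => (hf Q hQ hQP).symm.subset rfl
    refine ⟨f, V, δ, κ, hV, hδ, hκ, ?_, hf, fun Q₁ hQ₁ Q₂ hQ₂ h₁ h₂ => ?_⟩
    -- The selection extends `fP` automatically: `fP` is itself an equilibrium under `P` in `V`,
    -- where there is only one.
    · have : fP ∈ ({f P} : Set (EuclideanSpace ℝ Route)) :=
        (hf P hP (MLAPUE.dK_self.trans_le hδ.le)).subset ⟨hreg.1, mem_of_mem_nhds hV⟩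
      exact this.symm
    · have := hst Q₁ hQ₁ Q₂ hQ₂ h₁ h₂ _ (hmem Q₁ hQ₁ h₁) _ (hmem Q₂ hQ₂ h₂)
      rwa [hcoe] at this
  · have := hfam.exists_global_stability hclosed hFconv hγ hM.le hf hcont
    rwa [hcoe] at this
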